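/- Let $\tilde q(s,\theta)\ge 0$ be measurable, let $q(u,\sigma)=\tilde q(|u|,\theta)$ with $\theta$ the angle between $u\in\mathbb R^3$ and $\sigma\in S^2$, and suppose $\sup_{u}\int_{S^2}q(u,\sigma)\,d\sigma<\infty$ (for instance a Maxwellian gas with angular cutoff, where $q$ depends only on $\theta$). For $v,v_1\in\mathbb R^3$, $\sigma\in S^2$ put $$v'=\tfrac12(v+v_1)+\tfrac12|v-v_1|\sigma,\qquad v_1'=\tfrac12(v+v_1)-\tfrac12|v-v_1|\sigma ,$$ and write $g=g(v)$, $g_1=g(v_1)$, $g'=g(v')$, $g_1'=g(v_1')$. Define $$Q(g,g)(v)=\int_{\mathbb R^3}\int_{S^2}q(v-v_1,\sigma)\,(g_1'g'-g_1g)\,d\sigma\,dv_1,$$ $$L^*[g]\gamma(v)=\int_{\mathbb R^3}\int_{S^2}g_1\,(\gamma'+\gamma_1'-\gamma-\gamma_1)\,q(v-v_1,\sigma)\,d\sigma\,dv_1 .$$ Let $w:\mathbb R^3\to[1,\infty)$ be measurable with $w(v')\le w(v)w(v_1)$ for all $v,v_1,\sigma$ (for instance $(1+|v|^2)^{k/2}$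 with $k\ge0$, or $e^{a|v|^2}$ with $a\ge 0$), and let $X=L^1(\mathbb R^3,w\,dv)$. Let $r$ be measurable with $|r|\le C w$ for some constant $C$, let $T\ge0$, and let $f$ be a strong solution in $X$ of the spatially homogeneous Boltzmann equation on $[0,T]$, i.e. $f:[0,T]\to X$ is differentiable in the norm of $X$ and $\partial_t f=Q(f,f)$. (a) For every $t\in[0,T]$ and every $g$ in some neighbourhood of $f(\cdot,t)$ in $X$, the Boltzmann equation has exactly one strong solution $f^{t,g}$ on $[t,T]$ in $X$ with state $g$ at time $t$. Hence the objective $J_1=\int r(v)f(v,T)\,dv$, with $f$ constrained to solve the Boltzmann equation, is a function $J_1^{t}(g)=\int_{\mathbb R^3} r(v)f^{t,g}(v,T)\,dv$ of the state at time $t$, defined near $f(\cdot,t)$. (b) The adjoint problem $$-\partial_t\gamma(v,t)=L^*[f(\cdot,t)]\gamma(\cdot,t)(v)\quad(0\le t\le T,\ v\in\mathbb R^3),\qquad \gamma(v,T)=-r(v)$$ has a solution $\gamma$ which is measurable in $v$ and satisfies $|\gamma(v,t)|\le C'w(v)$ on $\mathbb R^3\times[0,T]$ for some constant $C'$. (c)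 If $\gamma$ is any such solution, then for every $t\in[0,T]$ $$\gamma(v,t)=-\frac{\delta J_1}{\delta f(v,t)} .$$ That is, $J_1^{t}$ is Fréchet differentiable on $X$ at $f(\cdot,t)$, with derivative $\delta f\mapsto\int_{\mathbb R^3}\bigl(-\gamma(v,t)\bigr)\,\delta f(v)\,dv$ (the integral converging absolutely for every $\delta f\in X$), and every function $\varphi$ which represents this derivative in the form $\delta f\mapsto\int\varphi\,\delta f\,dv$, with absolutely convergent integrals for all $\delta f\in X$, satisfies $\gamma(v,t)=-\varphi(v)$ for almost every $v$. In particular $-\delta J_1/\delta f$ satisfies the same backward equation $-\partial_t(\cdot)=L^*[f](\cdot)$ and the same final condition $-r(v)$ as $\gamma$. -/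

import Mathlib

open MeasureTheory Set Filter Topology
open scoped NNReal ENNReal

namespace BoltzmannAdjoint

/-- Velocity space with its Euclidean norm. -/
abbrev Velocity := EuclideanSpace ℝ (Fin 3)

/-- The unit sphere of velocity space. -/
abbrev UnitSphere := Metric.sphere (0 : Velocity) 1

/-- The surface measure on the unit sphere (total mass `4π`). -/
noncomputable def sphereMeasure : Measure UnitSphere :=
  (volume : Measure Velocity).toSphere

/-- The post-collisional velocity `v' = (v + v₁)/2 + |v - v₁| σ / 2`. -/
noncomputable def post (v v₁ : Velocity) (σ : UnitSphere) : Velocity :=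
  (1 / 2 : ℝ) • (v + v₁) + (1 / 2 * ‖v - v₁‖) • (σ : Velocity)

/-- The post-collisional velocity `v₁' = (v + v₁)/2 - |v - v₁| σ / 2`. -/
noncomputable def post₁ (v v₁ : Velocity) (σ : UnitSphere) : Velocity :=
  (1 / 2 : ℝ) • (v + v₁) - (1 / 2 * ‖v - v₁‖) • (σ : Velocity)

/-- The collision kernel `q(u, σ) = q̃(|u|, θ)`, where `θ` is the scattering angle between the
relative velocity `u = v - v₁` and `σ`. -/
noncomputable def kernel (qt : ℝ → ℝ → ℝ) (u : Velocity) (σ : UnitSphere) : ℝ :=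
  qt ‖u‖ (InnerProductGeometry.angle u (σ : Velocity))

/-- Nonnegative measurable collision kernels whose total cross section `∫ q(u, σ) dσ` is bounded
in the relative velocity `u`; this contains all Maxwellian kernels with angular cutoff. -/
structure IsCollisionKernel (qt : ℝ → ℝ → ℝ) : Prop where
  measurable : Measurable (Function.uncurry qt)
  nonneg : ∀ u σ, 0 ≤ kernel qt u σ
  bounded : ∃ C : ℝ≥0, ∀ u, ∫⁻ σ, ENNReal.ofReal (kernel qt u σ) ∂sphereMeasure ≤ C

/-- Weights that are submultiplicative along collisions, such as `(1 + |v|²)^(k/2)` with `k ≥ 0`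
and `exp (a |v|²)` with `a ≥ 0`. -/
structure IsCollisionWeight (w : Velocity → ℝ) : Prop where
  measurable : Measurable w
  one_le : ∀ v, 1 ≤ w v
  collision_le : ∀ v v₁ σ, w (post v v₁ σ) ≤ w v * w v₁

/-- The state space `L¹(w dv)`, a Banach space with norm `∫ |g(v)| w(v) dv`. -/
noncomputable abbrev StateSpace (w : Velocity → ℝ) :=
  Lp ℝ 1 ((volume : Measure Velocity).withDensity fun v => ENNReal.ofReal (w v))

/-- The Boltzmann collision operator `Q(g, g)`. -/
noncomputable def collisionOp (qt : ℝ → ℝ → ℝ) (g : Velocity → ℝ) (v : Velocity) : ℝ :=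
  ∫ v₁, ∫ σ, kernel qt (v - v₁) σ *
    (g (post₁ v v₁ σ) * g (post v v₁ σ) - g v₁ * g v) ∂sphereMeasure

/-- The adjoint linearised collision operator
`L*[g]γ = ∫∫ g₁ (γ' + γ₁' - γ - γ₁) q dσ dv₁`. -/
noncomputable def adjointOp (qt : ℝ → ℝ → ℝ) (g γ : Velocity → ℝ) (v : Velocity) : ℝ :=
  ∫ v₁, ∫ σ, g v₁ * (γ (post v v₁ σ) + γ (post₁ v v₁ σ) - γ v - γ v₁) *
    kernel qt (v - v₁) σ ∂sphereMeasure

/-- `F` is a (strong) solution on `[a, b]` of the spatially homogeneous Boltzmann equation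
`∂ₜ F = Q(F, F)`, the time derivative being taken in the norm of the state space. -/
def IsBoltzmannSolution (qt : ℝ → ℝ → ℝ) (w : Velocity → ℝ) (a b : ℝ)
    (F : ℝ → StateSpace w) : Prop :=
  ∀ s ∈ Icc a b, ∃ g : StateSpace w,
    (∀ᵐ v : Velocity, g v = collisionOp qt (F s) v) ∧ HasDerivWithinAt F g (Icc a b) s

/-- `γ` is a continuous adjoint variable for the solution `f` on `[0, T]`: it satisfies
`-∂ₜ γ = L*[f] γ` and `γ(v, T) = -r(v)` at every velocity, and is measurable in `v` and bounded by
a multiple of the weight uniformly in time. -/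
structure IsAdjointSolution (qt : ℝ → ℝ → ℝ) (w r : Velocity → ℝ) (T : ℝ)
    (f : ℝ → StateSpace w) (γ : ℝ → Velocity → ℝ) : Prop where
  measurable : ∀ t ∈ Icc 0 T, Measurable (γ t)
  bounded : ∃ C : ℝ, ∀ t ∈ Icc 0 T, ∀ v, |γ t v| ≤ C * w v
  backward : ∀ t ∈ Icc 0 T, ∀ v,
    HasDerivWithinAt (fun s => γ s v) (-adjointOp qt (f t) (γ t) v) (Icc 0 T) t
  final : ∀ v, γ T v = -r v

/-- The Boltzmann equation on `[t, T]` with state `g` at time `t` has exactly one solution. -/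
def IsUniquelySolvable (qt : ℝ → ℝ → ℝ) (w : Velocity → ℝ) (t T : ℝ)
    (g : StateSpace w) : Prop :=
  ∃ F : ℝ → StateSpace w, (IsBoltzmannSolution qt w t T F ∧ F t = g) ∧
    ∀ F' : ℝ → StateSpace w, IsBoltzmannSolution qt w t T F' → F' t = g → EqOn F' F (Icc t T)

open Classical in
/-- The state at time `T` of the solution of the Boltzmann equation that has state `g` at time `t`
(zero if there is no solution on `[t, T]`). -/
noncomputable def finalState (qt : ℝ → ℝ → ℝ) (w : Velocity → ℝ) (t T : ℝ)
    (g : StateSpace w) : StateSpace w :=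
  if h : ∃ F : ℝ → StateSpace w, IsBoltzmannSolution qt w t T F ∧ F t = g
  then h.choose T else 0

/-- The objective `J₁ = ∫ r(v) f(v, T) dv` as a function of the state `g = f(·, t)` at time `t`,
the later states being determined by the Boltzmann equation. -/
noncomputable def objective (qt : ℝ → ℝ → ℝ) (w r : Velocity → ℝ) (t T : ℝ)
    (g : StateSpace w) : ℝ :=
  ∫ v, r v * finalState qt w t T g v

/-- `φ` is the density of the Fréchet derivative of `J` at `g`, that is `φ = δJ/δg`: the function
`J` is Fréchet differentiable at `g` and `δJ = ∫ φ(v) δg(v) dv`. -/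
def IsFunctionalDerivative {w : Velocity → ℝ} (J : StateSpace w → ℝ) (g : StateSpace w)
    (φ : Velocity → ℝ) : Prop :=
  ∃ D : StateSpace w →L[ℝ] ℝ, HasFDerivAt J D g ∧
    ∀ h : StateSpace w, Integrable (fun v => φ v * h v) ∧ D h = ∫ v, φ v * h v

end BoltzmannAdjoint

open BoltzmannAdjoint

/-!
The collision transformation `(v, v₁, σ) ↦ (v', v₁', (v - v₁) / |v - v₁|)` preserves both the
measure `dv dv₁ dσ` (`measurePreserving_collision`) and the kernel `q` (`kernel_collision`), and it
carries `(v', v₁')` back to `(v, v₁)`. In polar coordinates for the relative velocity it only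
exchanges two points of the sphere, and the centre of mass goes along by a translation. Two facts
follow for a bounded cross section and a weight with `w(v') ≤ w(v) w(v₁)`. The collision operator
is the diagonal of a bounded bilinear map `B` on `L¹(w dv)` (`exists_clm_collisionOp`). And `L*[f]`
is the transpose of the linearisation `h ↦ B(f, h) + B(h, f)` with respect to the pairing
`∫ γ h dv` (`integral_mul_linearised_eq`).

The Boltzmann equation is thus the ordinary differential equation `F' = B(F, F)` in a Banach space.
Solutions are unique by Grönwall's inequality, and near a solution on `[t, T]` all initial values
have solutions on the same interval that stay within `L ‖g - f(t)‖` of it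
(`exists_hasDerivWithinAt_quadratic_near`). The adjoint equation is required to hold at every
velocity, so it is solved, as a linear equation backwards in time, in the space of functions `γ`
for which `γ / w` is bounded and measurable, with no identification of functions that agree almost
everywhere (`exists_isAdjointSolution`).

For the derivative of the objective no linearised flow is needed. If `F` and `f` are two solutions
and `h = F - f`, then `h' = B(f, h) + B(h, f) + B(h, h)`, so by duality
`d/ds ∫ γ h dv = ∫ γ B(h, h) dv`, which is of second order in `h(t)`
(`exists_abs_pairing_sub_le`). Since `∫ γ(T) h(T) dv = -∫ r (F(T) - f(T)) dv`, the change of the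
objective equals `-∫ γ(t) h(t) dv` up to `O(‖h(t)‖²)`. The density of the derivative is unique
because `L¹(w dv)` contains a positive function and its restrictions to all measurable sets.
-/

namespace BoltzmannAdjoint

/-! ### Global solutions of ordinary differential equations -/

/-- The radial retraction of a normed space onto the closed ball of radius `R`. -/
noncomputable def radialRetraction {E : Type*} [NormedAddCommGroup E] [NormedSpace ℝ E]
    (R : ℝ) (x : E) : E :=
  (R / max R ‖x‖) • x

section Retraction

variable {E : Type*} [NormedAddCommGroup E] [NormedSpace ℝ E] {R : ℝ}

theorem radialRetraction_of_norm_le (hR : 0 < R) {x : E} (hx : ‖x‖ ≤ R) :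
    radialRetraction R x = x := by
  rw [radialRetraction, max_eq_left hx, div_self hR.ne', one_smul]

theorem norm_radialRetraction_le (hR : 0 < R) (x : E) : ‖radialRetraction R x‖ ≤ R := by
  have hm : 0 < max R ‖x‖ := lt_max_of_lt_left hR
  rw [radialRetraction, norm_smul, Real.norm_of_nonneg (by positivity), div_mul_eq_mul_div,
    div_le_iff₀ hm]
  exact mul_le_mul_of_nonneg_left (le_max_right _ _) hR.le

theorem norm_radialRetraction_le_norm (hR : 0 < R) (x : E) : ‖radialRetraction R x‖ ≤ ‖x‖ := by
  have hm : 0 < max R ‖x‖ := lt_max_of_lt_left hR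
  rw [radialRetraction, norm_smul, Real.norm_of_nonneg (by positivity)]
  exact mul_le_of_le_one_left (norm_nonneg x) ((div_le_one hm).2 (le_max_left _ _))

theorem lipschitzWith_radialRetraction (hR : 0 < R) :
    LipschitzWith 2 (radialRetraction R : E → E) := by
  refine LipschitzWith.of_dist_le_mul fun x y => ?_
  have hx : 0 < max R ‖x‖ := lt_max_of_lt_left hR
  have hy : 0 < max R ‖y‖ := lt_max_of_lt_left hR
  have hle : R / max R ‖x‖ ≤ 1 := (div_le_one hx).2 (le_max_left _ _)
  have hmax : |max R ‖y‖ - max R ‖x‖| ≤ ‖x - y‖ := by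
    refine (abs_max_sub_max_le_max R ‖y‖ R ‖x‖).trans ?_
    rw [sub_self, abs_zero, max_eq_right (abs_nonneg _), abs_sub_comm]
    exact abs_norm_sub_norm_le x y
  have hsplit : radialRetraction R x - radialRetraction R y =
      (R / max R ‖x‖) • (x - y) + (R / max R ‖x‖ - R / max R ‖y‖) • y := by
    simp only [radialRetraction, smul_sub, sub_smul]; abel
  have h1 : ‖(R / max R ‖x‖) • (x - y)‖ ≤ ‖x - y‖ := by
    rw [norm_smul, Real.norm_of_nonneg (by positivity)]
    exact mul_le_of_le_one_left (norm_nonneg _) hle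
  have h2 : ‖(R / max R ‖x‖ - R / max R ‖y‖) • y‖ ≤ ‖x - y‖ := by
    have : R / max R ‖x‖ - R / max R ‖y‖ =
        (R / max R ‖x‖) * ((max R ‖y‖ - max R ‖x‖) / max R ‖y‖) := by
      field_simp
    rw [norm_smul, this, Real.norm_eq_abs, abs_mul,
      abs_of_nonneg (show 0 ≤ R / max R ‖x‖ by positivity), abs_div, abs_of_pos hy]
    calc R / max R ‖x‖ * (|max R ‖y‖ - max R ‖x‖| / max R ‖y‖) * ‖y‖
        ≤ 1 * (‖x - y‖ / max R ‖y‖) * max R ‖y‖ := by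
          gcongr
          exact le_max_right _ _
      _ = ‖x - y‖ := by field_simp
  rw [dist_eq_norm, dist_eq_norm, hsplit]
  refine (norm_add_le _ _).trans ?_
  have : ((2 : ℝ≥0) : ℝ) = 2 := rfl
  rw [this]; linarith

end Retraction

theorem hasDerivWithinAt_Ici_of_Icc {E : Type*} [NormedAddCommGroup E] [NormedSpace ℝ E]
    {F : ℝ → E} {F' : E} {a b s : ℝ} (h : HasDerivWithinAt F F' (Icc a b) s) (hs : s ∈ Ico a b) :
    HasDerivWithinAt F F' (Ici s) s :=
  h.mono_of_mem_nhdsWithin (mem_of_superset (Icc_mem_nhdsGE hs.2) (Icc_subset_Icc_left hs.1))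

theorem norm_le_mul_exp_of_norm_deriv_le {E : Type*} [NormedAddCommGroup E] [NormedSpace ℝ E]
    {y y' : ℝ → E} {a b K : ℝ} (hy : ∀ s ∈ Icc a b, HasDerivWithinAt y (y' s) (Icc a b) s)
    (hb : ∀ s ∈ Icc a b, ‖y' s‖ ≤ K * ‖y s‖) :
    ∀ s ∈ Icc a b, ‖y s‖ ≤ ‖y a‖ * Real.exp (K * (s - a)) := by
  intro s hs
  have := norm_le_gronwallBound_of_norm_deriv_right_le (f := y) (f' := y') (δ := ‖y a‖) (K := K)
    (ε := 0) (a := a) (b := b) (fun s hs => (hy s hs).continuousWithinAt)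
    (fun s hs => hasDerivWithinAt_Ici_of_Icc (hy s (Ico_subset_Icc_self hs)) hs) le_rfl
    (fun s hs => by simpa using hb s (Ico_subset_Icc_self hs)) s hs
  rwa [gronwallBound_ε0] at this

/-- A vector field that vanishes at `0` and is `K`-Lipschitz on the ball of radius `R` has a
solution on the whole of `[a, b]` from every initial value that Grönwall's bound keeps in that
ball. Precomposing the field with the radial retraction onto the ball makes it globally bounded
and Lipschitz, so that the Picard–Lindelöf theorem applies on `[a, b]`, and Grönwall's bound shows
that the retraction has no effect along the solution. -/
theorem exists_solution_of_lipschitzOnWith_closedBall {E : Type*} [NormedAddCommGroup E]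
    [NormedSpace ℝ E] [CompleteSpace E] {a b : ℝ} (hab : a ≤ b) {V : ℝ → E → E} {K : ℝ≥0} {R : ℝ}
    (hR : 0 < R) (hVc : ∀ x, ContinuousOn (fun s => V s x) (Icc a b))
    (hV0 : ∀ s ∈ Icc a b, V s 0 = 0)
    (hlip : ∀ s ∈ Icc a b, LipschitzOnWith K (V s) (Metric.closedBall 0 R))
    (x₀ : E) (hx₀ : ‖x₀‖ * Real.exp (K * (b - a)) ≤ R) :
    ∃ y : ℝ → E, y a = x₀ ∧ ∀ s ∈ Icc a b,
      HasDerivWithinAt y (V s (y s)) (Icc a b) s ∧ ‖y s‖ ≤ ‖x₀‖ * Real.exp (K * (s - a)) := by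
  have hmem : ∀ x : E, radialRetraction R x ∈ Metric.closedBall (0 : E) R := fun x => by
    simpa using norm_radialRetraction_le hR x
  have hVnorm : ∀ s ∈ Icc a b, ∀ x ∈ Metric.closedBall (0 : E) R, ‖V s x‖ ≤ K * ‖x‖ := by
    intro s hs x hx
    have := (hlip s hs).dist_le_mul x hx 0 (by simp [hR.le])
    simpa [hV0 s hs] using this
  have hRn : ((R.toNNReal : ℝ≥0) : ℝ) = R := Real.coe_toNNReal _ hR.le
  set A : ℝ≥0 := K * R.toNNReal * (b - a).toNNReal with hA
  have hpl : IsPicardLindelof (fun s x => V s (radialRetraction R x)) (tmin := a) (tmax := b)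
      ⟨a, left_mem_Icc.2 hab⟩ x₀ A 0 (K * R.toNNReal) (K * 2) := by
    refine ⟨fun s hs => ?_, fun x _ => hVc _, fun s hs x _ => ?_, ?_⟩
    · exact ((hlip s hs).comp (lipschitzWith_radialRetraction hR).lipschitzOnWith
        (fun x _ => hmem x))
    · rw [NNReal.coe_mul, hRn]
      exact (hVnorm s hs _ (hmem x)).trans
        (mul_le_mul_of_nonneg_left (norm_radialRetraction_le hR x) K.2)
    · simp [hA, hab]
  obtain ⟨y, hya, hy⟩ := hpl.exists_eq_forall_mem_Icc_hasDerivWithinAt₀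
  have hya : y a = x₀ := hya
  have hbound : ∀ s ∈ Icc a b, ‖y s‖ ≤ ‖x₀‖ * Real.exp (K * (s - a)) := by
    rw [← hya]
    exact norm_le_mul_exp_of_norm_deriv_le hy fun s hs => (hVnorm s hs _ (hmem _)).trans
      (mul_le_mul_of_nonneg_left (norm_radialRetraction_le_norm hR _) K.2)
  refine ⟨y, hya, fun s hs => ⟨?_, hbound s hs⟩⟩
  have hle : ‖y s‖ ≤ R := (hbound s hs).trans (le_trans (by gcongr; exact hs.2) hx₀)
  simpa only [radialRetraction_of_norm_le hR hle] using hy s hs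

theorem exists_norm_le_of_continuousOn {E : Type*} [NormedAddCommGroup E] {a b : ℝ} {F : ℝ → E}
    (hF : ContinuousOn F (Icc a b)) : ∃ M : ℝ≥0, ∀ s ∈ Icc a b, ‖F s‖ ≤ M := by
  obtain ⟨M, hM⟩ := isCompact_Icc.exists_bound_of_continuousOn hF
  exact ⟨M.toNNReal, fun s hs => (hM s hs).trans (Real.le_coe_toNNReal M)⟩

section Quadratic

variable {E : Type*} [NormedAddCommGroup E] [NormedSpace ℝ E] (B : E →L[ℝ] E →L[ℝ] E) {a b : ℝ}

theorem eqOn_of_hasDerivWithinAt_quadratic {F F' : ℝ → E}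
    (hF : ∀ s ∈ Icc a b, HasDerivWithinAt F (B (F s) (F s)) (Icc a b) s)
    (hF' : ∀ s ∈ Icc a b, HasDerivWithinAt F' (B (F' s) (F' s)) (Icc a b) s)
    (h : F a = F' a) : EqOn F F' (Icc a b) := by
  obtain ⟨M, hM⟩ := exists_norm_le_of_continuousOn fun s hs => (hF s hs).continuousWithinAt
  obtain ⟨M', hM'⟩ := exists_norm_le_of_continuousOn fun s hs => (hF' s hs).continuousWithinAt
  intro s hs
  have := norm_le_mul_exp_of_norm_deriv_le (y := fun s => F s - F' s) (K := ‖B‖ * M + ‖B‖ * M')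
    (fun s hs => (hF s hs).sub (hF' s hs)) (fun s hs => ?_) s hs
  · simpa [h, sub_eq_zero] using this
  · have heq : B (F s) (F s) - B (F' s) (F' s) =
        B (F s - F' s) (F s) + B (F' s) (F s - F' s) := by
      simp only [map_sub, sub_apply]; abel
    rw [heq]
    calc ‖B (F s - F' s) (F s) + B (F' s) (F s - F' s)‖
        ≤ ‖B‖ * ‖F s - F' s‖ * ‖F s‖ + ‖B‖ * ‖F' s‖ * ‖F s - F' s‖ :=
          (norm_add_le _ _).trans (add_le_add (B.le_opNorm₂ _ _) (B.le_opNorm₂ _ _))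
      _ ≤ ‖B‖ * ‖F s - F' s‖ * M + ‖B‖ * M' * ‖F s - F' s‖ := by
          gcongr
          exacts [hM s hs, hM' s hs]
      _ = _ := by ring

/-- The difference `h` of two solutions of `∂ₜ F = B(F, F)` satisfies
`∂ₜ h = B(f, h) + B(h, f) + B(h, h)`, a field that vanishes at `h = 0` and is Lipschitz on the unit
ball, so that it can be solved on the whole interval for all small initial values. -/
theorem exists_hasDerivWithinAt_quadratic_near [CompleteSpace E] (hab : a ≤ b) {f : ℝ → E}
    (hf : ∀ s ∈ Icc a b, HasDerivWithinAt f (B (f s) (f s)) (Icc a b) s) :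
    ∃ δ > 0, ∃ L : ℝ, ∀ g : E, ‖g - f a‖ ≤ δ → ∃ F : ℝ → E,
      (∀ s ∈ Icc a b, HasDerivWithinAt F (B (F s) (F s)) (Icc a b) s) ∧ F a = g ∧
        ∀ s ∈ Icc a b, ‖F s - f s‖ ≤ L * ‖g - f a‖ := by
  have hfc : ContinuousOn f (Icc a b) := fun s hs => (hf s hs).continuousWithinAt
  obtain ⟨M, hM⟩ := exists_norm_le_of_continuousOn hfc
  -- the two terms linear in `h` contribute `2 M`, the quadratic one `2` on the unit ball
  set K : ℝ≥0 := ‖B‖₊ * (2 * M + 2) with hK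
  have hKc : (K : ℝ) = ‖B‖ * (2 * M + 2) := by simp [hK]
  refine ⟨Real.exp (-(K * (b - a))), Real.exp_pos _, Real.exp (K * (b - a)), fun g hg => ?_⟩
  have hlip : ∀ s ∈ Icc a b, LipschitzOnWith K (fun x => B (f s) x + B x (f s) + B x x)
      (Metric.closedBall 0 1) := fun s hs => LipschitzOnWith.of_dist_le_mul fun x hx y hy => by
    rw [mem_closedBall_zero_iff] at hx hy
    have heq : B (f s) x + B x (f s) + B x x - (B (f s) y + B y (f s) + B y y) =
        B (f s) (x - y) + B (x - y) (f s) + (B (x - y) x + B y (x - y)) := by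
      simp only [map_sub, sub_apply]; abel
    rw [dist_eq_norm, dist_eq_norm, heq, hKc]
    calc _ ≤ ‖B‖ * ‖f s‖ * ‖x - y‖ + ‖B‖ * ‖x - y‖ * ‖f s‖ +
          (‖B‖ * ‖x - y‖ * ‖x‖ + ‖B‖ * ‖y‖ * ‖x - y‖) :=
          (norm_add_le _ _).trans (add_le_add
            ((norm_add_le _ _).trans (add_le_add (B.le_opNorm₂ _ _) (B.le_opNorm₂ _ _)))
            ((norm_add_le _ _).trans (add_le_add (B.le_opNorm₂ _ _) (B.le_opNorm₂ _ _))))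
      _ ≤ ‖B‖ * M * ‖x - y‖ + ‖B‖ * ‖x - y‖ * M +
          (‖B‖ * ‖x - y‖ * 1 + ‖B‖ * 1 * ‖x - y‖) := by
          have := hM s hs
          gcongr
      _ = _ := by ring
  have hsmall : ‖g - f a‖ * Real.exp (K * (b - a)) ≤ 1 :=
    calc ‖g - f a‖ * Real.exp (K * (b - a))
        ≤ Real.exp (-(K * (b - a))) * Real.exp (K * (b - a)) := by gcongr
      _ = 1 := by rw [← Real.exp_add, neg_add_cancel, Real.exp_zero]
  obtain ⟨h, ha, hh⟩ := exists_solution_of_lipschitzOnWith_closedBall hab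
    (V := fun s x => B (f s) x + B x (f s) + B x x) one_pos
    (fun x => ((((ContinuousLinearMap.apply ℝ _ x).continuous.comp B.continuous).comp_continuousOn
      hfc).add ((B x).continuous.comp_continuousOn hfc)).add continuousOn_const)
    (fun s _ => by simp) hlip (g - f a) hsmall
  refine ⟨fun s => f s + h s, fun s hs => ?_, by simp [ha],
    fun s hs => ?_⟩
  · convert! (hf s hs).add (hh s hs).1 using 1
    simp only [map_add, add_apply]; abel
  · rw [add_sub_cancel_left, mul_comm]
    refine (hh s hs).2.trans ?_
    gcongr
    exact hs.2

theorem apply_quadratic_sub_quadratic (D : E →L[ℝ] ℝ) (x y : E) :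
    D (B x x - B y y) = D (B y (x - y)) + D (B (x - y) y) + D (B (x - y) (x - y)) := by
  simp only [map_sub, sub_apply]; ring

end Quadratic

/-! ### The collision transformation -/

instance : IsFiniteMeasure sphereMeasure := inferInstanceAs (IsFiniteMeasure (Measure.toSphere _))

theorem post₁_eq_post_neg (v v₁ : Velocity) (σ : UnitSphere) : post₁ v v₁ σ = post v v₁ (-σ) := by
  simp [post, post₁, sub_eq_add_neg]

theorem post_swap_neg (v v₁ : Velocity) (σ : UnitSphere) : post v₁ v (-σ) = post₁ v v₁ σ := by
  simp [post, post₁, sub_eq_add_neg, add_comm v₁ v, ← norm_neg (v + -v₁)]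

theorem kernel_neg_neg (qt : ℝ → ℝ → ℝ) (u : Velocity) (σ : UnitSphere) :
    kernel qt (-u) (-σ) = kernel qt u σ := by
  simp [kernel]

theorem measurable_kernel {qt : ℝ → ℝ → ℝ} (hqt : IsCollisionKernel qt) :
    Measurable fun x : Velocity × UnitSphere => kernel qt x.1 x.2 := by
  refine hqt.measurable.comp (measurable_fst.norm.prodMk ?_)
  fun_prop

theorem continuous_post : Continuous fun x : Velocity × Velocity × UnitSphere =>
    post x.1 x.2.1 x.2.2 := by
  unfold post; fun_prop

theorem continuous_post₁ : Continuous fun x : Velocity × Velocity × UnitSphere =>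
    post₁ x.1 x.2.1 x.2.2 := by
  unfold post₁; fun_prop

open scoped Pointwise in
theorem measurePreserving_neg_sphereMeasure :
    MeasurePreserving (fun σ : UnitSphere => -σ) sphereMeasure sphereMeasure := by
  have hm : Measurable fun σ : UnitSphere => -σ := continuous_neg.measurable
  refine ⟨hm, Measure.ext fun s hs => ?_⟩
  rw [Measure.map_apply hm hs, sphereMeasure, Measure.toSphere_apply' _ (hm hs),
    Measure.toSphere_apply' _ hs]
  congr 1
  have : Ioo (0 : ℝ) 1 • ((fun σ : UnitSphere => (σ : Velocity)) '' ((fun σ => -σ) ⁻¹' s)) =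
      Neg.neg ⁻¹' (Ioo (0 : ℝ) 1 • ((fun σ : UnitSphere => (σ : Velocity)) '' s)) := by
    ext x
    simp only [Set.mem_smul, mem_image, mem_preimage]
    constructor
    · rintro ⟨c, hc, _, ⟨σ, hσ, rfl⟩, rfl⟩
      exact ⟨c, hc, _, ⟨-σ, hσ, rfl⟩, by simp⟩
    · rintro ⟨c, hc, _, ⟨σ, hσ, rfl⟩, hx⟩
      exact ⟨c, hc, _, ⟨-σ, by simpa using hσ, rfl⟩, by simp [hx]⟩
  exact (congrArg _ this).trans (Measure.measure_preimage_neg _ _)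

/-- Polar coordinates `(ω, ρ) ↦ ρ ω` on velocity space. -/
theorem measurePreserving_polar :
    MeasurePreserving (fun p : UnitSphere × Ioi (0 : ℝ) => (p.2 : ℝ) • (p.1 : Velocity))
      (sphereMeasure.prod (Measure.volumeIoiPow (Module.finrank ℝ Velocity - 1))) volume := by
  have h1 := ((volume : Measure Velocity).measurePreserving_homeomorphUnitSphereProd).symm
    (homeomorphUnitSphereProd Velocity).toMeasurableEquiv
  have h2 := measurePreserving_subtype_coe (μa := (volume : Measure Velocity))
    (measurableSet_singleton (0 : Velocity)).compl
  rw [restrict_compl_singleton] at h2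
  exact h2.comp h1

open Classical in
/-- The exchange of the directions of the relative velocity `u` and of `σ`: it sends `(u, σ)` to
`(|u| σ, u / |u|)`, and fixes the pairs with `u = 0`. -/
noncomputable def exchange (p : Velocity × UnitSphere) : Velocity × UnitSphere :=
  (‖p.1‖ • (p.2 : Velocity),
    if h : p.1 = 0 then p.2 else ⟨‖p.1‖⁻¹ • p.1, by simp [norm_smul, h]⟩)

theorem measurable_exchange : Measurable exchange := by
  refine Measurable.prodMk (by fun_prop) ?_
  refine (MeasurableEmbedding.subtype_coe
    Metric.isClosed_sphere.measurableSet).measurable_comp_iff.1 ?_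
  have : (Subtype.val ∘ fun p : Velocity × UnitSphere => (exchange p).2) =
      fun p => if p.1 = 0 then (p.2 : Velocity) else ‖p.1‖⁻¹ • p.1 := by
    funext p
    simp only [exchange, Function.comp_apply]
    split_ifs <;> rfl
  refine (congrArg Measurable this).mpr (Measurable.ite ?_ (by fun_prop) (by fun_prop))
  exact measurable_fst (measurableSet_singleton 0)

theorem exchange_polar (ω σ : UnitSphere) {ρ : ℝ} (hρ : 0 < ρ) :
    exchange (ρ • (ω : Velocity), σ) = (ρ • (σ : Velocity), ω) := by
  have hω : (ω : Velocity) ≠ 0 := ne_zero_of_mem_unit_sphere ω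
  have hn : ‖ρ • (ω : Velocity)‖ = ρ := by simp [norm_smul, hρ.le]
  refine Prod.ext (by simp [exchange, norm_smul, abs_of_pos hρ]) (Subtype.ext ?_)
  simp only [exchange, smul_eq_zero, hρ.ne', hω, or_self, dite_false]
  rw [hn, smul_smul, inv_mul_cancel₀ hρ.ne', one_smul]

theorem measurePreserving_prod_rightComm {α β δ : Type*} [MeasurableSpace α] [MeasurableSpace β]
    [MeasurableSpace δ] (μ : Measure α) (ν : Measure β) (τ : Measure δ) [SFinite μ] [SFinite ν]
    [SFinite τ] :
    MeasurePreserving (fun x : (α × β) × δ => ((x.1.1, x.2), x.1.2)) ((μ.prod ν).prod τ)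
      ((μ.prod τ).prod ν) :=
  ((measurePreserving_prodAssoc μ τ ν).symm MeasurableEquiv.prodAssoc).comp
    (((MeasurePreserving.id μ).prod (Measure.measurePreserving_swap (μ := ν) (ν := τ))).comp
      (measurePreserving_prodAssoc μ ν τ))

/-- In polar coordinates `u = ρ ω` the map swaps `ω` and `σ`, which carry the same measure. -/
theorem measurePreserving_exchange :
    MeasurePreserving exchange ((volume : Measure Velocity).prod sphereMeasure)
      ((volume : Measure Velocity).prod sphereMeasure) := by
  set κ := Measure.volumeIoiPow (Module.finrank ℝ Velocity - 1)
  have hP := measurePreserving_polar.prod (MeasurePreserving.id sphereMeasure)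
  have hτ : MeasurePreserving
      (fun x : (UnitSphere × Ioi (0 : ℝ)) × UnitSphere => ((x.2, x.1.2), x.1.1))
      ((sphereMeasure.prod κ).prod sphereMeasure) ((sphereMeasure.prod κ).prod sphereMeasure) := by
    have h1 := measurePreserving_prodAssoc sphereMeasure κ sphereMeasure
    have h2 := (MeasurePreserving.id sphereMeasure).prod
      (Measure.measurePreserving_swap (μ := κ) (ν := sphereMeasure))
    have h3 := Measure.measurePreserving_swap (μ := sphereMeasure) (ν := sphereMeasure.prod κ)
    exact h3.comp (h2.comp h1)
  refine ⟨measurable_exchange, ?_⟩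
  conv_lhs => rw [← hP.map_eq, Measure.map_map measurable_exchange hP.measurable]
  have hcomm : exchange ∘
      Prod.map (fun p : UnitSphere × Ioi (0 : ℝ) => (p.2 : ℝ) • (p.1 : Velocity)) id =
      Prod.map (fun p : UnitSphere × Ioi (0 : ℝ) => (p.2 : ℝ) • (p.1 : Velocity)) id ∘
        fun x : (UnitSphere × Ioi (0 : ℝ)) × UnitSphere => ((x.2, x.1.2), x.1.1) := by
    funext x
    exact exchange_polar _ _ x.1.2.2
  rw [hcomm]
  exact (hP.comp hτ).map_eq

theorem kernel_exchange (qt : ℝ → ℝ → ℝ) (p : Velocity × UnitSphere) :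
    kernel qt (exchange p).1 (exchange p).2 = kernel qt p.1 p.2 := by
  obtain ⟨u, σ⟩ := p
  by_cases hu : u = 0
  · simp [exchange, hu]
  · have hn : 0 < ‖u‖ := norm_pos_iff.2 hu
    simp only [kernel, exchange, hu, dite_false, norm_smul, norm_norm, norm_eq_of_mem_sphere,
      mul_one]
    rw [InnerProductGeometry.angle_smul_left_of_pos _ _ hn,
      InnerProductGeometry.angle_smul_right_of_pos _ _ (inv_pos.2 hn),
      InnerProductGeometry.angle_comm]

/-- The measure `dv dv₁ dσ` on the set of collisions. -/
noncomputable def collisionMeasure : Measure (Velocity × Velocity × UnitSphere) :=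
  (volume : Measure Velocity).prod ((volume : Measure Velocity).prod sphereMeasure)

/-- The collision transformation `(v, v₁, σ) ↦ (v', v₁', (v - v₁) / |v - v₁|)`. -/
noncomputable def collision (x : Velocity × Velocity × UnitSphere) :
    Velocity × Velocity × UnitSphere :=
  (post x.1 x.2.1 x.2.2, post₁ x.1 x.2.1 x.2.2, (exchange (x.1 - x.2.1, x.2.2)).2)

/-- The relabelling `(v, v₁, σ) ↦ (v₁, v, -σ)` of the two particles. -/
noncomputable def relabel (x : Velocity × Velocity × UnitSphere) :
    Velocity × Velocity × UnitSphere :=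
  (x.2.1, x.1, -x.2.2)

theorem post_sub_post₁ (v v₁ : Velocity) (σ : UnitSphere) :
    post v v₁ σ - post₁ v v₁ σ = (exchange (v - v₁, σ)).1 := by
  simp only [post, post₁, exchange]; module

theorem kernel_collision (qt : ℝ → ℝ → ℝ) (x : Velocity × Velocity × UnitSphere) :
    kernel qt ((collision x).1 - (collision x).2.1) (collision x).2.2 =
      kernel qt (x.1 - x.2.1) x.2.2 := by
  simp only [collision, post_sub_post₁, kernel_exchange]

/-- A second collision along `(v - v₁) / |v - v₁|` restores the velocities `v` and `v₁`. -/
theorem post_post₁_collision (x : Velocity × Velocity × UnitSphere) :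
    post (collision x).1 (collision x).2.1 (collision x).2.2 = x.1 ∧
      post₁ (collision x).1 (collision x).2.1 (collision x).2.2 = x.2.1 := by
  obtain ⟨v, v₁, σ⟩ := x
  have hadd : post v v₁ σ + post₁ v v₁ σ = v + v₁ := by simp only [post, post₁]; module
  have hn : ‖post v v₁ σ - post₁ v v₁ σ‖ = ‖v - v₁‖ := by
    simp [post_sub_post₁, exchange, norm_smul]
  have hdir : ‖v - v₁‖ • (((exchange (v - v₁, σ)).2 : UnitSphere) : Velocity) = v - v₁ := by
    by_cases h : v - v₁ = 0
    · simp [h]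
    · simp [exchange, h, smul_smul]
  simp only [collision]
  constructor
  · rw [post, hadd, hn, mul_smul, hdir]; module
  · rw [post₁, hadd, hn, mul_smul, hdir]; module

/-- In the coordinates `(v - v₁, σ)` and `v₁`, a collision is the exchange of directions followed
by a translation of `v₁`. -/
theorem measurePreserving_collision :
    MeasurePreserving collision collisionMeasure collisionMeasure := by
  have hE := measurePreserving_exchange
  -- the relative coordinates `(v, v₁, σ) ↦ ((v - v₁, σ), v₁)` and their inverse
  have hrel : MeasurePreserving
      (fun x : Velocity × Velocity × UnitSphere => ((x.1 - x.2.1, x.2.2), x.2.1)) collisionMeasure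
      (((volume : Measure Velocity).prod sphereMeasure).prod volume) :=
    (measurePreserving_prod_rightComm _ _ _).comp
      (((measurePreserving_sub_prod (volume : Measure Velocity) (volume : Measure Velocity)).prod
        (MeasurePreserving.id sphereMeasure)).comp
        ((measurePreserving_prodAssoc _ _ _).symm MeasurableEquiv.prodAssoc))
  have hrel' : MeasurePreserving
      (fun y : (Velocity × UnitSphere) × Velocity => (y.1.1 + y.2, y.2, y.1.2))
      (((volume : Measure Velocity).prod sphereMeasure).prod volume) collisionMeasure :=
    (measurePreserving_prodAssoc _ _ _).comp
      (((measurePreserving_add_prod (volume : Measure Velocity) (volume : Measure Velocity)).prod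
        (MeasurePreserving.id sphereMeasure)).comp (measurePreserving_prod_rightComm _ _ _))
  have hskew := hE.skew_product (μc := (volume : Measure Velocity))
    (μd := (volume : Measure Velocity))
    (g := fun p v₁ => v₁ + (1 / 2 : ℝ) • (p.1 - (exchange p).1))
    (by
      have := measurable_exchange.fst
      unfold Function.uncurry
      fun_prop)
    (ae_of_all _ fun p => map_add_right_eq_self _ _)
  have h := hrel'.comp (hskew.comp hrel)
  convert! h using 1
  funext x
  have h1 := post_sub_post₁ x.1 x.2.1 x.2.2
  have h2 : post₁ x.1 x.2.1 x.2.2 = x.2.1 + (1 / 2 : ℝ) • (x.1 - x.2.1 -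
      (exchange (x.1 - x.2.1, x.2.2)).1) := by
    rw [← h1]; simp only [post, post₁]; module
  refine Prod.ext ?_ (Prod.ext h2 rfl)
  simp only [collision, Function.comp_apply]
  rw [← h2, ← h1, sub_add_cancel]

theorem measurePreserving_relabel :
    MeasurePreserving relabel collisionMeasure collisionMeasure := by
  have h1 := (measurePreserving_prodAssoc (volume : Measure Velocity) (volume : Measure Velocity)
      sphereMeasure).symm MeasurableEquiv.prodAssoc
  have h2 := (Measure.measurePreserving_swap (μ := (volume : Measure Velocity))
    (ν := (volume : Measure Velocity))).prod measurePreserving_neg_sphereMeasure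
  have h3 := measurePreserving_prodAssoc (volume : Measure Velocity) (volume : Measure Velocity)
      sphereMeasure
  exact h3.comp (h2.comp h1)

/-! ### Integrability of collision integrands -/

theorem IsCollisionWeight.pos {w : Velocity → ℝ} (hw : IsCollisionWeight w) (v : Velocity) :
    0 < w v :=
  zero_lt_one.trans_le (hw.one_le v)

theorem IsCollisionWeight.collision_le₁ {w : Velocity → ℝ} (hw : IsCollisionWeight w)
    (v v₁ : Velocity) (σ : UnitSphere) : w (post₁ v v₁ σ) ≤ w v * w v₁ := by
  rw [post₁_eq_post_neg]
  exact hw.collision_le _ _ _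

theorem IsCollisionWeight.le_mul_left {w : Velocity → ℝ} (hw : IsCollisionWeight w)
    (v v₁ : Velocity) : w v ≤ w v * w v₁ :=
  le_mul_of_one_le_right (hw.pos v).le (hw.one_le v₁)

theorem IsCollisionWeight.le_mul_right {w : Velocity → ℝ} (hw : IsCollisionWeight w)
    (v v₁ : Velocity) : w v₁ ≤ w v * w v₁ :=
  le_mul_of_one_le_left (hw.pos v₁).le (hw.one_le v)

theorem nonneg_of_abs_le_mul_weight {w : Velocity → ℝ} (hw : IsCollisionWeight w)
    {φ : Velocity → ℝ} {c : ℝ} (hφ : ∀ v, |φ v| ≤ c * w v) : 0 ≤ c :=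
  nonneg_of_mul_nonneg_left ((abs_nonneg _).trans (hφ 0)) (hw.pos 0)

theorem integral_comp_of_measurePreserving {α β : Type*} [MeasurableSpace α] [MeasurableSpace β]
    {μ : Measure α} {ν : Measure β} {f : α → β} (hf : MeasurePreserving f μ ν) {g : β → ℝ}
    (hg : AEStronglyMeasurable g ν) : ∫ x, g (f x) ∂μ = ∫ y, g y ∂ν := by
  rw [← hf.map_eq] at hg ⊢
  exact (integral_map hf.measurable.aemeasurable hg).symm

/-- Integrating out `σ` against the kernel costs at most the total cross section. -/
theorem integrable_kernel_mul {qt : ℝ → ℝ → ℝ} (hqt : IsCollisionKernel qt) {C : ℝ≥0}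
    (hC : ∀ u, ∫⁻ σ, ENNReal.ofReal (kernel qt u σ) ∂sphereMeasure ≤ C) {α : Type*}
    [MeasurableSpace α] {τ : Measure α} [SFinite τ] {u : α → Velocity} (hu : Measurable u)
    {F : α → ℝ} (hF : Integrable F τ) :
    Integrable (fun y : α × UnitSphere => kernel qt (u y.1) y.2 * F y.1) (τ.prod sphereMeasure) ∧
      ∫ y, ‖kernel qt (u y.1) y.2 * F y.1‖ ∂(τ.prod sphereMeasure) ≤ C * ∫ a, ‖F a‖ ∂τ := by
  have hk : Measurable fun y : α × UnitSphere => kernel qt (u y.1) y.2 :=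
    (measurable_kernel hqt).comp (f := fun y : α × UnitSphere => (u y.1, y.2)) (by fun_prop)
  have hm : AEStronglyMeasurable (fun y : α × UnitSphere => kernel qt (u y.1) y.2 * F y.1)
      (τ.prod sphereMeasure) :=
    AEStronglyMeasurable.mul (f := fun y : α × UnitSphere => kernel qt (u y.1) y.2)
      (g := fun y => F y.1) hk.aestronglyMeasurable hF.aestronglyMeasurable.comp_fst
  have hle : ∫⁻ y, ‖kernel qt (u y.1) y.2 * F y.1‖ₑ ∂(τ.prod sphereMeasure) ≤
      C * ∫⁻ a, ‖F a‖ₑ ∂τ := by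
    rw [lintegral_prod _ hm.enorm, ← lintegral_const_mul' _ _ ENNReal.coe_ne_top]
    refine lintegral_mono fun a => ?_
    simp only [enorm_mul]
    rw [lintegral_mul_const' _ _ enorm_ne_top]
    gcongr
    refine le_trans (lintegral_mono fun σ => ?_) (hC (u a))
    rw [Real.enorm_eq_ofReal (hqt.nonneg _ _)]
  have hfin : C * ∫⁻ a, ‖F a‖ₑ ∂τ ≠ ∞ := ENNReal.mul_ne_top ENNReal.coe_ne_top hF.2.ne
  refine ⟨⟨hm, hle.trans_lt hfin.lt_top⟩, ?_⟩
  rw [integral_norm_eq_lintegral_enorm hm, integral_norm_eq_lintegral_enorm hF.1]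
  refine (ENNReal.toReal_mono hfin hle).trans_eq ?_
  rw [ENNReal.toReal_mul, ENNReal.coe_toReal]

section Collision

variable {qt : ℝ → ℝ → ℝ} (hqt : IsCollisionKernel qt) {C : ℝ≥0}
  (hC : ∀ u, ∫⁻ σ, ENNReal.ofReal (kernel qt u σ) ∂sphereMeasure ≤ C)
  {w : Velocity → ℝ} (hw : IsCollisionWeight w)
  {G : Velocity → Velocity → ℝ}
  (hG : Integrable (fun p : Velocity × Velocity => w p.1 * w p.2 * G p.1 p.2)
    ((volume : Measure Velocity).prod volume))

include hqt in
theorem measurable_collision_kernel : Measurable fun x : Velocity × Velocity × UnitSphere =>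
    kernel qt (x.1 - x.2.1) x.2.2 :=
  (measurable_kernel hqt).comp
    (f := fun x : Velocity × Velocity × UnitSphere => (x.1 - x.2.1, x.2.2)) (by fun_prop)

include hqt hC hw hG in
theorem integrable_kernel_mul_pair {ψ : Velocity × Velocity × UnitSphere → ℝ}
    (hψ : Measurable ψ) {c : ℝ} (hψc : ∀ x, |ψ x| ≤ c * (w x.1 * w x.2.1)) :
    Integrable (fun x => kernel qt (x.1 - x.2.1) x.2.2 * (ψ x * G x.1 x.2.1)) collisionMeasure ∧
      ∫ x, ‖kernel qt (x.1 - x.2.1) x.2.2 * (ψ x * G x.1 x.2.1)‖ ∂collisionMeasure ≤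
        c * (C * ∫ p : Velocity × Velocity, ‖w p.1 * w p.2 * G p.1 p.2‖
          ∂((volume : Measure Velocity).prod volume)) := by
  obtain ⟨h1, h2⟩ := integrable_kernel_mul hqt hC (u := fun p : Velocity × Velocity => p.1 - p.2)
    (by fun_prop) hG
  have hassoc : MeasurePreserving
      (fun x : Velocity × Velocity × UnitSphere => ((x.1, x.2.1), x.2.2)) collisionMeasure
      (((volume : Measure Velocity).prod volume).prod sphereMeasure) :=
    (measurePreserving_prodAssoc _ _ _).symm MeasurableEquiv.prodAssoc
  have h1' := hassoc.integrable_comp_of_integrable h1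
  have h2' := integral_comp_of_measurePreserving hassoc h1.norm.aestronglyMeasurable
  rw [← h2'] at h2
  have hwm : Measurable fun x : Velocity × Velocity × UnitSphere => w x.1 * w x.2.1 :=
    (hw.measurable.comp measurable_fst).mul (hw.measurable.comp measurable_snd.fst)
  have hpos : ∀ x : Velocity × Velocity × UnitSphere, 0 < w x.1 * w x.2.1 := fun x =>
    mul_pos (hw.pos _) (hw.pos _)
  have hbd : ∀ x : Velocity × Velocity × UnitSphere, ‖ψ x / (w x.1 * w x.2.1)‖ ≤ c := fun x => by
    rw [Real.norm_eq_abs, abs_div, abs_of_pos (hpos x), div_le_iff₀ (hpos x)]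
    exact hψc x
  have heq : (fun x : Velocity × Velocity × UnitSphere =>
      kernel qt (x.1 - x.2.1) x.2.2 * (ψ x * G x.1 x.2.1)) = fun x => ψ x / (w x.1 * w x.2.1) *
        (kernel qt (x.1 - x.2.1) x.2.2 * (w x.1 * w x.2.1 * G x.1 x.2.1)) := by
    funext x
    have h1 := (hw.pos x.1).ne'
    have h2 := (hw.pos x.2.1).ne'
    field_simp
  have h3 : Integrable (fun x : Velocity × Velocity × UnitSphere => ψ x / (w x.1 * w x.2.1) *
        (kernel qt (x.1 - x.2.1) x.2.2 * (w x.1 * w x.2.1 * G x.1 x.2.1))) collisionMeasure :=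
    h1'.bdd_mul (hψ.div hwm).aestronglyMeasurable (ae_of_all _ hbd)
  -- any collision yields the sign of `c`
  have hc : 0 ≤ c := (norm_nonneg _).trans (hbd (0, 0, ⟨EuclideanSpace.single 0 1, by simp⟩))
  refine ⟨heq ▸ h3, ?_⟩
  calc ∫ x, ‖kernel qt (x.1 - x.2.1) x.2.2 * (ψ x * G x.1 x.2.1)‖ ∂collisionMeasure
      ≤ ∫ x : Velocity × Velocity × UnitSphere, c *
          ‖kernel qt (x.1 - x.2.1) x.2.2 * (w x.1 * w x.2.1 * G x.1 x.2.1)‖ ∂collisionMeasure := by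
        refine integral_mono (heq ▸ h3).norm (h1'.norm.const_mul c) fun x => ?_
        have := congrFun heq x
        simp only at this ⊢
        rw [this, norm_mul]
        exact mul_le_mul_of_nonneg_right (hbd x) (norm_nonneg _)
    _ ≤ _ := by
        rw [integral_const_mul]
        exact mul_le_mul_of_nonneg_left h2 hc

/-- The integrand `q (G(v', v₁') - G(v, v₁))` of the collision operator, for a general function
`G` of two velocities in place of `g(v) g(v₁)`. -/
noncomputable def collisionIntegrand (qt : ℝ → ℝ → ℝ) (G : Velocity → Velocity → ℝ)
    (x : Velocity × Velocity × UnitSphere) : ℝ :=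
  kernel qt (x.1 - x.2.1) x.2.2 *
    (G (post x.1 x.2.1 x.2.2) (post₁ x.1 x.2.1 x.2.2) - G x.1 x.2.1)

include hqt hC hw hG in
/-- The weak form of the collision integrand: since the collision transformation preserves
`q dv dv₁ dσ` and exchanges `(v, v₁)` with `(v', v₁')`, the difference can be moved onto the test
function `φ`. -/
theorem integrable_mul_collisionIntegrand {φ : Velocity → ℝ} (hφ : Measurable φ) {c : ℝ}
    (hφc : ∀ v, |φ v| ≤ c * w v) :
    Integrable (fun x => φ x.1 * collisionIntegrand qt G x) collisionMeasure ∧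
      ∫ x, φ x.1 * collisionIntegrand qt G x ∂collisionMeasure =
        ∫ x : Velocity × Velocity × UnitSphere, kernel qt (x.1 - x.2.1) x.2.2 *
          ((φ (post x.1 x.2.1 x.2.2) - φ x.1) * G x.1 x.2.1) ∂collisionMeasure ∧
      ∫ x, ‖φ x.1 * collisionIntegrand qt G x‖ ∂collisionMeasure ≤
        2 * c * (C * ∫ p : Velocity × Velocity, ‖w p.1 * w p.2 * G p.1 p.2‖
          ∂((volume : Measure Velocity).prod volume)) := by
  have hc := nonneg_of_abs_le_mul_weight hw hφc
  obtain ⟨hl, hl'⟩ := integrable_kernel_mul_pair hqt hC hw hG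
    (ψ := fun x => φ x.1) (hφ.comp measurable_fst) (c := c) fun x =>
      (hφc _).trans (mul_le_mul_of_nonneg_left (hw.le_mul_left _ _) hc)
  obtain ⟨hg, hg'⟩ := integrable_kernel_mul_pair hqt hC hw hG
    (ψ := fun x => φ (post x.1 x.2.1 x.2.2)) (hφ.comp continuous_post.measurable) (c := c) fun x =>
      (hφc _).trans (mul_le_mul_of_nonneg_left (hw.collision_le _ _ _) hc)
  have hcomp : ∀ x, (fun x : Velocity × Velocity × UnitSphere => kernel qt (x.1 - x.2.1) x.2.2 *
      (φ (post x.1 x.2.1 x.2.2) * G x.1 x.2.1)) (collision x) =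
        kernel qt (x.1 - x.2.1) x.2.2 *
          (φ x.1 * G (post x.1 x.2.1 x.2.2) (post₁ x.1 x.2.1 x.2.2)) := fun x => by
    simp only [kernel_collision, (post_post₁_collision x).1]
    rfl
  have hp : Integrable (fun x : Velocity × Velocity × UnitSphere =>
      kernel qt (x.1 - x.2.1) x.2.2 *
        (φ x.1 * G (post x.1 x.2.1 x.2.2) (post₁ x.1 x.2.1 x.2.2))) collisionMeasure :=
    (measurePreserving_collision.integrable_comp_of_integrable hg).congr (ae_of_all _ hcomp)
  have hpi := integral_comp_of_measurePreserving measurePreserving_collision hg.aestronglyMeasurable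
  have hpn := integral_comp_of_measurePreserving measurePreserving_collision
    hg.norm.aestronglyMeasurable
  simp only [fun x => hcomp x] at hpi hpn
  have heq : (fun x => φ x.1 * collisionIntegrand qt G x) = fun x =>
      kernel qt (x.1 - x.2.1) x.2.2 *
        (φ x.1 * G (post x.1 x.2.1 x.2.2) (post₁ x.1 x.2.1 x.2.2)) -
      kernel qt (x.1 - x.2.1) x.2.2 * (φ x.1 * G x.1 x.2.1) := by
    funext x
    simp only [collisionIntegrand]
    ring
  refine ⟨heq ▸ hp.sub hl, ?_, ?_⟩
  · rw [heq, integral_sub hp hl, hpi, ← integral_sub hg hl]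
    exact integral_congr_ae (ae_of_all _ fun x => by ring)
  · simp only [fun x => congrFun heq x]
    calc _ ≤ ∫ x : Velocity × Velocity × UnitSphere, (‖kernel qt (x.1 - x.2.1) x.2.2 *
          (φ x.1 * G (post x.1 x.2.1 x.2.2) (post₁ x.1 x.2.1 x.2.2))‖ +
          ‖kernel qt (x.1 - x.2.1) x.2.2 * (φ x.1 * G x.1 x.2.1)‖) ∂collisionMeasure :=
          integral_mono (hp.sub hl).norm (hp.norm.add hl.norm) fun x => norm_sub_le _ _
      _ ≤ _ := by
          rw [integral_add hp.norm hl.norm, hpn]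
          linarith

/-- The collision operator applied to a general function `G` of two velocities in place of
`g(v) g(v₁)`. -/
noncomputable def pairCollisionOp (qt : ℝ → ℝ → ℝ) (G : Velocity → Velocity → ℝ) (v : Velocity) :
    ℝ :=
  ∫ v₁, ∫ σ, collisionIntegrand qt G (v, v₁, σ) ∂sphereMeasure

theorem collisionOp_eq_pairCollisionOp (qt : ℝ → ℝ → ℝ) (g : Velocity → ℝ) :
    collisionOp qt g = pairCollisionOp qt fun v v₁ => g v₁ * g v :=
  rfl

include hqt hC hw hG in
theorem ae_integrable_collisionIntegrand : ∀ᵐ v : Velocity,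
    Integrable (fun y => collisionIntegrand qt G (v, y))
      ((volume : Measure Velocity).prod sphereMeasure) := by
  have h := (integrable_mul_collisionIntegrand hqt hC hw hG hw.measurable (c := 1)
    fun v => by rw [abs_of_pos (hw.pos v), one_mul]).1
  filter_upwards [Integrable.prod_right_ae h] with v hv
  exact (integrable_const_mul_iff (hw.pos v).ne'.isUnit _).1 hv

include hqt hC hw hG in
theorem pairCollisionOp_ae_eq : ∀ᵐ v : Velocity, pairCollisionOp qt G v =
    ∫ y, collisionIntegrand qt G (v, y) ∂((volume : Measure Velocity).prod sphereMeasure) := by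
  filter_upwards [ae_integrable_collisionIntegrand hqt hC hw hG] with v hv
  exact (integral_prod _ hv).symm

include hqt hC hw hG in
theorem integrable_mul_pairCollisionOp {φ : Velocity → ℝ} (hφ : Measurable φ) {c : ℝ}
    (hφc : ∀ v, |φ v| ≤ c * w v) :
    Integrable (fun v => φ v * pairCollisionOp qt G v) ∧
      ∫ v, φ v * pairCollisionOp qt G v =
        ∫ x : Velocity × Velocity × UnitSphere, kernel qt (x.1 - x.2.1) x.2.2 *
          ((φ (post x.1 x.2.1 x.2.2) - φ x.1) * G x.1 x.2.1) ∂collisionMeasure ∧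
      ∫ v, ‖φ v * pairCollisionOp qt G v‖ ≤
        2 * c * (C * ∫ p : Velocity × Velocity, ‖w p.1 * w p.2 * G p.1 p.2‖
          ∂((volume : Measure Velocity).prod volume)) := by
  obtain ⟨h1, h2, h3⟩ := integrable_mul_collisionIntegrand hqt hC hw hG hφ hφc
  have hae : (fun v => ∫ y, φ v * collisionIntegrand qt G (v, y)
      ∂((volume : Measure Velocity).prod sphereMeasure)) =ᵐ[volume]
        fun v => φ v * pairCollisionOp qt G v := by
    filter_upwards [pairCollisionOp_ae_eq hqt hC hw hG] with v hv
    rw [integral_const_mul, hv]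
  have hi : Integrable (fun v => φ v * pairCollisionOp qt G v) :=
    (Integrable.integral_prod_left h1).congr hae
  refine ⟨hi, ?_, ?_⟩
  · rw [← h2, ← integral_congr_ae hae]
    exact (integral_prod _ h1).symm
  · refine le_trans ?_ h3
    calc ∫ v, ‖φ v * pairCollisionOp qt G v‖
        ≤ ∫ v, ∫ y, ‖φ v * collisionIntegrand qt G (v, y)‖
            ∂((volume : Measure Velocity).prod sphereMeasure) := by
          refine integral_mono_ae hi.norm (Integrable.integral_norm_prod_left h1) ?_
          filter_upwards [hae] with v hv
          rw [← hv]
          exact norm_integral_le_integral_norm _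
      _ = _ := (integral_prod _ h1.norm).symm

include hqt hC hw hG in
theorem pairCollisionOp_ae_linear {G' G'' : Velocity → Velocity → ℝ}
    (hG' : Integrable (fun p : Velocity × Velocity => w p.1 * w p.2 * G' p.1 p.2)
      ((volume : Measure Velocity).prod volume)) (a : ℝ)
    (h : ∀ᵐ p : Velocity × Velocity ∂((volume : Measure Velocity).prod volume),
      G'' p.1 p.2 = a * G p.1 p.2 + G' p.1 p.2) :
    ∀ᵐ v : Velocity, pairCollisionOp qt G'' v =
      a * pairCollisionOp qt G v + pairCollisionOp qt G' v := by
  have hG'' : Integrable (fun p : Velocity × Velocity => w p.1 * w p.2 * G'' p.1 p.2)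
      ((volume : Measure Velocity).prod volume) := by
    refine ((hG.const_mul a).add hG').congr ?_
    filter_upwards [h] with p hp
    simp only [Pi.add_apply, hp]
    ring
  have hpair : MeasurePreserving
      (fun x : Velocity × Velocity × UnitSphere => ((x.1, x.2.1), x.2.2)) collisionMeasure
      (((volume : Measure Velocity).prod volume).prod sphereMeasure) :=
    (measurePreserving_prodAssoc _ _ _).symm MeasurableEquiv.prodAssoc
  have hq := (Measure.quasiMeasurePreserving_fst (μ := (volume : Measure Velocity).prod volume)
    (ν := sphereMeasure)).comp hpair.quasiMeasurePreserving
  have h1 := hq.ae h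
  have h2 := measurePreserving_collision.quasiMeasurePreserving.ae h1
  have h3 : ∀ᵐ x ∂collisionMeasure, collisionIntegrand qt G'' x =
      a * collisionIntegrand qt G x + collisionIntegrand qt G' x := by
    filter_upwards [h1, h2] with x hx hx'
    simp only [collision, Function.comp_apply] at hx hx'
    simp only [collisionIntegrand, hx, hx']
    ring
  filter_upwards [Measure.ae_ae_of_ae_prod h3, pairCollisionOp_ae_eq hqt hC hw hG,
    pairCollisionOp_ae_eq hqt hC hw hG', pairCollisionOp_ae_eq hqt hC hw hG'',
    ae_integrable_collisionIntegrand hqt hC hw hG,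
    ae_integrable_collisionIntegrand hqt hC hw hG'] with v hv e e' e'' i i'
  rw [e, e', e'', integral_congr_ae hv, integral_add (i.const_mul a) i', integral_const_mul]

end Collision

/-! ### The collision operator on the state space -/

section StateSpace

variable {w : Velocity → ℝ} (hw : IsCollisionWeight w)

include hw in
theorem integrable_withDensity_weight_iff {g : Velocity → ℝ} :
    Integrable g ((volume : Measure Velocity).withDensity fun v => ENNReal.ofReal (w v)) ↔
      Integrable fun v => w v * g v := by
  rw [integrable_withDensity_iff_integrable_smul' hw.measurable.ennreal_ofReal
    (ae_of_all _ fun v => ENNReal.ofReal_lt_top)]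
  simp only [ENNReal.toReal_ofReal (hw.pos _).le, smul_eq_mul]

include hw in
theorem ae_withDensity_weight_iff {p : Velocity → Prop} :
    (∀ᵐ v ∂((volume : Measure Velocity).withDensity fun v => ENNReal.ofReal (w v)), p v) ↔
      ∀ᵐ v : Velocity, p v := by
  have h := withDensity_absolutelyContinuous' (μ := (volume : Measure Velocity))
    hw.measurable.ennreal_ofReal.aemeasurable
    (ae_of_all _ fun v => (ENNReal.ofReal_pos.2 (hw.pos v)).ne')
  exact ⟨fun hp => h.ae_le hp, fun hp => (withDensity_absolutelyContinuous _ _).ae_le hp⟩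

include hw in
theorem integrable_weight_mul (g : StateSpace w) : Integrable fun v => w v * g v :=
  (integrable_withDensity_weight_iff hw).1 (L1.integrable_coeFn g)

include hw in
theorem norm_stateSpace_eq (g : StateSpace w) : ‖g‖ = ∫ v, ‖w v * g v‖ := by
  rw [L1.norm_eq_integral_norm]
  have := integral_withDensity_eq_integral_smul (μ := (volume : Measure Velocity))
    hw.measurable.real_toNNReal fun v => ‖g v‖
  refine this.trans (integral_congr_ae (ae_of_all _ fun v => ?_))
  simp only [NNReal.smul_def, Real.coe_toNNReal _ (hw.pos v).le, norm_mul,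
    Real.norm_of_nonneg (hw.pos v).le, smul_eq_mul]

include hw in
theorem exists_stateSpace_ae_eq {g : Velocity → ℝ} (hg : Integrable fun v => w v * g v) :
    ∃ h : StateSpace w, ∀ᵐ v : Velocity, h v = g v :=
  ⟨((integrable_withDensity_weight_iff hw).2 hg).toL1 g,
    (ae_withDensity_weight_iff hw).1 (Integrable.coeFn_toL1 _)⟩

include hw in
theorem stateSpace_ext {g h : StateSpace w} (hgh : ∀ᵐ v : Velocity, g v = h v) : g = h :=
  Lp.ext ((ae_withDensity_weight_iff hw).2 hgh)

include hw in
theorem coeFn_add_ae (g h : StateSpace w) : ∀ᵐ v : Velocity, (g + h) v = g v + h v :=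
  (ae_withDensity_weight_iff hw).1 (Lp.coeFn_add g h)

include hw in
theorem coeFn_sub_ae (g h : StateSpace w) : ∀ᵐ v : Velocity, (g - h) v = g v - h v :=
  (ae_withDensity_weight_iff hw).1 (Lp.coeFn_sub g h)

include hw in
theorem coeFn_smul_ae (a : ℝ) (g : StateSpace w) : ∀ᵐ v : Velocity, (a • g) v = a * g v :=
  (ae_withDensity_weight_iff hw).1 (Lp.coeFn_smul a g)

include hw in
theorem integrable_mul_stateSpace {φ : Velocity → ℝ} (hφ : Measurable φ) {c : ℝ}
    (hφc : ∀ v, |φ v| ≤ c * w v) (g : StateSpace w) :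
    Integrable (fun v => φ v * g v) ∧ |∫ v, φ v * g v| ≤ c * ‖g‖ := by
  have hg := integrable_weight_mul hw g
  have heq : (fun v => φ v * g v) = fun v => φ v / w v * (w v * g v) := by
    funext v
    have := (hw.pos v).ne'
    field_simp
  have hbd : ∀ v, ‖φ v / w v‖ ≤ c := fun v => by
    rw [Real.norm_eq_abs, abs_div, abs_of_pos (hw.pos v), div_le_iff₀ (hw.pos v)]
    exact hφc v
  have hi : Integrable fun v => φ v * g v :=
    heq ▸ hg.bdd_mul (hφ.div hw.measurable).aestronglyMeasurable (ae_of_all _ hbd)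
  refine ⟨hi, ?_⟩
  rw [norm_stateSpace_eq hw, ← integral_const_mul]
  refine (norm_integral_le_integral_norm _).trans (integral_mono hi.norm (hg.norm.const_mul c) ?_)
  intro v
  simp only [congrFun heq v]
  rw [norm_mul]
  exact mul_le_mul_of_nonneg_right (hbd v) (norm_nonneg _)

include hw in
/-- Integration against a measurable function bounded by a multiple of the weight is a continuous
linear functional on the state space. -/
theorem exists_clm_integral_mul {φ : Velocity → ℝ} (hφ : Measurable φ) {c : ℝ}
    (hφc : ∀ v, |φ v| ≤ c * w v) :
    ∃ D : StateSpace w →L[ℝ] ℝ, ∀ g : StateSpace w, D g = ∫ v, φ v * g v := by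
  refine ⟨LinearMap.mkContinuous
    { toFun := fun g : StateSpace w => ∫ v, φ v * g v
      map_add' := fun g h => ?_
      map_smul' := fun a g => ?_ } c fun g => (integrable_mul_stateSpace hw hφ hφc g).2,
    fun g => rfl⟩
  · rw [← integral_add (integrable_mul_stateSpace hw hφ hφc g).1
      (integrable_mul_stateSpace hw hφ hφc h).1]
    refine integral_congr_ae ?_
    filter_upwards [coeFn_add_ae hw g h] with v hv
    rw [hv, mul_add]
  · rw [RingHom.id_apply, smul_eq_mul, ← integral_const_mul]
    refine integral_congr_ae ?_
    filter_upwards [coeFn_smul_ae hw a g] with v hv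
    rw [hv, mul_left_comm]

include hw in
theorem integrable_weight_pair (g h : StateSpace w) :
    Integrable (fun p : Velocity × Velocity => w p.1 * w p.2 * (g p.2 * h p.1))
      ((volume : Measure Velocity).prod volume) ∧
    ∫ p : Velocity × Velocity, ‖w p.1 * w p.2 * (g p.2 * h p.1)‖
      ∂((volume : Measure Velocity).prod volume) = ‖g‖ * ‖h‖ := by
  have heq : (fun p : Velocity × Velocity => w p.1 * w p.2 * (g p.2 * h p.1)) =
      fun p => w p.1 * h p.1 * (w p.2 * g p.2) := by
    funext p; ring
  refine ⟨heq ▸ (integrable_weight_mul hw h).mul_prod (integrable_weight_mul hw g), ?_⟩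
  simp only [fun p => congrFun heq p]
  rw [norm_stateSpace_eq hw g, norm_stateSpace_eq hw h, mul_comm, ← integral_prod_mul]
  simp only [norm_mul]

/-- The collision operator is the diagonal of the bounded bilinear map
`(g, h) ↦ ∫∫ q (g(v₁') h(v') - g(v₁) h(v)) dσ dv₁`. -/
theorem exists_clm_collisionOp {qt : ℝ → ℝ → ℝ} (hqt : IsCollisionKernel qt)
    {w : Velocity → ℝ} (hw : IsCollisionWeight w) :
    ∃ B : StateSpace w →L[ℝ] StateSpace w →L[ℝ] StateSpace w, ∀ g h : StateSpace w,
      ∀ᵐ v : Velocity, B g h v = pairCollisionOp qt (fun v v₁ => g v₁ * h v) v := by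
  obtain ⟨C, hC⟩ := hqt.bounded
  have hwc : ∀ v, |w v| ≤ 1 * w v := fun v => by rw [abs_of_pos (hw.pos v), one_mul]
  have hQ : ∀ g h : StateSpace w, _ := fun g h => integrable_mul_pairCollisionOp hqt hC hw
    (G := fun v v₁ => g v₁ * h v) (integrable_weight_pair hw g h).1 hw.measurable hwc
  choose B hB using fun g h : StateSpace w => exists_stateSpace_ae_eq hw (hQ g h).1
  have hlin : ∀ (a : ℝ) (g h g' h' g'' h'' : StateSpace w),
      (∀ᵐ p : Velocity × Velocity ∂((volume : Measure Velocity).prod volume),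
        g'' p.2 * h'' p.1 = a * (g p.2 * h p.1) + g' p.2 * h' p.1) →
      B g'' h'' = a • B g h + B g' h' := by
    intro a g h g' h' g'' h'' H
    refine stateSpace_ext hw ?_
    filter_upwards [hB g h, hB g' h', hB g'' h'', coeFn_add_ae hw (a • B g h) (B g' h'),
      coeFn_smul_ae hw a (B g h), pairCollisionOp_ae_linear hqt hC hw
        (G := fun v v₁ => g v₁ * h v) (G' := fun v v₁ => g' v₁ * h' v)
        (G'' := fun v v₁ => g'' v₁ * h'' v) (integrable_weight_pair hw g h).1
        (integrable_weight_pair hw g' h').1 a H]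
      with v h1 h2 h3 h4 h5 h6
    rw [h3, h6, h4, h5, h1, h2]
  have hfst : ∀ {p : Velocity → Prop}, (∀ᵐ v : Velocity, p v) →
      ∀ᵐ x : Velocity × Velocity ∂((volume : Measure Velocity).prod volume), p x.1 :=
    fun h => Measure.quasiMeasurePreserving_fst.ae h
  have hsnd : ∀ {p : Velocity → Prop}, (∀ᵐ v : Velocity, p v) →
      ∀ᵐ x : Velocity × Velocity ∂((volume : Measure Velocity).prod volume), p x.2 :=
    fun h => Measure.quasiMeasurePreserving_snd.ae h
  have h0 : ∀ᵐ v : Velocity, (0 : StateSpace w) v = 0 :=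
    (ae_withDensity_weight_iff hw).1 (Lp.coeFn_zero _ _ _)
  have hB0 : B 0 0 = 0 := by
    have := hlin 1 0 0 0 0 0 0 (by
      filter_upwards [hfst h0] with p hp
      simp only [hp, mul_zero, add_zero])
    simpa using this
  let Bl : StateSpace w →ₗ[ℝ] StateSpace w →ₗ[ℝ] StateSpace w := LinearMap.mk₂ ℝ B
    (fun g g' h => by
      have := hlin 1 g h g' h (g + g') h (by
        filter_upwards [hsnd (coeFn_add_ae hw g g')] with p hp
        rw [hp]; ring)
      simpa using this)
    (fun a g h => by
      have := hlin a g h 0 0 (a • g) h (by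
        filter_upwards [hsnd (coeFn_smul_ae hw a g), hfst h0] with p hp hp0
        rw [hp, hp0]; ring)
      simpa [hB0] using this)
    (fun g h h' => by
      have := hlin 1 g h g h' g (h + h') (by
        filter_upwards [hfst (coeFn_add_ae hw h h')] with p hp
        rw [hp]; ring)
      simpa using this)
    (fun a g h => by
      have := hlin a g h 0 0 g (a • h) (by
        filter_upwards [hfst (coeFn_smul_ae hw a h), hfst h0] with p hp hp0
        rw [hp, hp0]; ring)
      simpa [hB0] using this)
  refine ⟨Bl.mkContinuous₂ (2 * 1 * C) fun g h => ?_, hB⟩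
  have h1 := (hQ g h).2.2
  rw [(integrable_weight_pair hw g h).2] at h1
  calc ‖B g h‖ = ∫ v, ‖w v * pairCollisionOp qt (fun v v₁ => g v₁ * h v) v‖ := by
        rw [norm_stateSpace_eq hw]
        refine integral_congr_ae ?_
        filter_upwards [hB g h] with v hv
        rw [hv]
    _ ≤ _ := h1
    _ = _ := by ring

end StateSpace

/-! ### The adjoint linearised operator -/

section Adjoint

variable {qt : ℝ → ℝ → ℝ} (hqt : IsCollisionKernel qt) {C : ℝ≥0}
  (hC : ∀ u, ∫⁻ σ, ENNReal.ofReal (kernel qt u σ) ∂sphereMeasure ≤ C)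
  {w : Velocity → ℝ} (hw : IsCollisionWeight w) (g : StateSpace w)
  {φ : Velocity → ℝ} (hφ : Measurable φ) {c : ℝ} (hφc : ∀ v, |φ v| ≤ c * w v)

include hw hφc in
theorem abs_collision_difference_le (v v₁ : Velocity) (σ : UnitSphere) :
    |φ (post v v₁ σ) + φ (post₁ v v₁ σ) - φ v - φ v₁| ≤ 4 * c * (w v * w v₁) := by
  have hc := nonneg_of_abs_le_mul_weight hw hφc
  have h1 := (hφc _).trans (mul_le_mul_of_nonneg_left (hw.collision_le v v₁ σ) hc)
  have h2 := (hφc _).trans (mul_le_mul_of_nonneg_left (hw.collision_le₁ v v₁ σ) hc)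
  have h3 := (hφc _).trans (mul_le_mul_of_nonneg_left (hw.le_mul_left v v₁) hc)
  have h4 := (hφc _).trans (mul_le_mul_of_nonneg_left (hw.le_mul_right v v₁) hc)
  rw [abs_le] at *
  constructor <;> linarith

include hφ in
theorem measurable_collision_difference : Measurable fun x : Velocity × Velocity × UnitSphere =>
    φ (post x.1 x.2.1 x.2.2) + φ (post₁ x.1 x.2.1 x.2.2) - φ x.1 - φ x.2.1 :=
  (((hφ.comp continuous_post.measurable).add (hφ.comp continuous_post₁.measurable)).sub
    (hφ.comp measurable_fst)).sub (hφ.comp measurable_snd.fst)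

include hqt hφ in
theorem measurable_adjointIntegrand : Measurable fun x : Velocity × Velocity × UnitSphere =>
    g x.2.1 * (φ (post x.1 x.2.1 x.2.2) + φ (post₁ x.1 x.2.1 x.2.2) - φ x.1 - φ x.2.1) *
      kernel qt (x.1 - x.2.1) x.2.2 :=
  (((Lp.stronglyMeasurable g).measurable.comp measurable_snd.fst).mul
    (measurable_collision_difference hφ)).mul (measurable_collision_kernel hqt)

include hqt hC hw hφ hφc in
theorem integrable_adjointIntegrand (v : Velocity) :
    Integrable (fun y : Velocity × UnitSphere =>
      g y.1 * (φ (post v y.1 y.2) + φ (post₁ v y.1 y.2) - φ v - φ y.1) * kernel qt (v - y.1) y.2)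
      ((volume : Measure Velocity).prod sphereMeasure) ∧
    |adjointOp qt g φ v| ≤ 4 * c * C * ‖g‖ * w v := by
  obtain ⟨h1, h2⟩ := integrable_kernel_mul hqt hC (u := fun v₁ : Velocity => v - v₁)
    (by fun_prop) (integrable_weight_mul hw g)
  rw [← norm_stateSpace_eq hw] at h2
  have hle : ∀ y : Velocity × UnitSphere,
      ‖g y.1 * (φ (post v y.1 y.2) + φ (post₁ v y.1 y.2) - φ v - φ y.1) * kernel qt (v - y.1) y.2‖ ≤
        4 * c * w v * ‖kernel qt (v - y.1) y.2 * (w y.1 * g y.1)‖ := fun y => by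
    have := abs_collision_difference_le hw hφc v y.1 y.2
    simp only [norm_mul, Real.norm_eq_abs, abs_of_pos (hw.pos y.1)]
    calc _ ≤ |g y.1| * (4 * c * (w v * w y.1)) * |kernel qt (v - y.1) y.2| := by gcongr
      _ = _ := by ring
  have hi : Integrable (fun y : Velocity × UnitSphere =>
      g y.1 * (φ (post v y.1 y.2) + φ (post₁ v y.1 y.2) - φ v - φ y.1) * kernel qt (v - y.1) y.2)
      ((volume : Measure Velocity).prod sphereMeasure) :=
    (h1.norm.const_mul (4 * c * w v)).mono' ((measurable_adjointIntegrand hqt g hφ).comp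
      (measurable_prodMk_left (x := v))).aestronglyMeasurable (ae_of_all _ hle)
  refine ⟨hi, ?_⟩
  have heq : adjointOp qt g φ v = _ := (integral_prod _ hi).symm
  have hc := nonneg_of_abs_le_mul_weight hw hφc
  have hwv := (hw.pos v).le
  rw [heq]
  calc _ ≤ _ := norm_integral_le_integral_norm _
    _ ≤ _ := integral_mono hi.norm (h1.norm.const_mul (4 * c * w v)) hle
    _ ≤ 4 * c * w v * (C * ‖g‖) := by
        rw [integral_const_mul]
        exact mul_le_mul_of_nonneg_left h2 (by positivity)
    _ = _ := by ring

include hqt hC hw hφ hφc in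
theorem adjointOp_eq_integral_prod (v : Velocity) : adjointOp qt g φ v =
    ∫ y : Velocity × UnitSphere,
      g y.1 * (φ (post v y.1 y.2) + φ (post₁ v y.1 y.2) - φ v - φ y.1) * kernel qt (v - y.1) y.2
      ∂((volume : Measure Velocity).prod sphereMeasure) :=
  (integral_prod _ (integrable_adjointIntegrand hqt hC hw g hφ hφc v).1).symm

include hqt hC hw hφ hφc in
theorem measurable_adjointOp : Measurable (adjointOp qt g φ) := by
  rw [funext (adjointOp_eq_integral_prod hqt hC hw g hφ hφc)]
  exact ((measurable_adjointIntegrand hqt g hφ).stronglyMeasurable.integral_prod_right'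
    (ν := (volume : Measure Velocity).prod sphereMeasure)).measurable

include hqt hC hw hφ hφc in
/-- `L*[f]` is the transpose of the linearisation `h ↦ B(f, h) + B(h, f)` of the collision
operator at `f`: after passing to the weak form, the second term is relabelled so that both carry
the factor `f(v₁) h(v)`. -/
theorem integral_mul_linearised_eq {B : StateSpace w →L[ℝ] StateSpace w →L[ℝ] StateSpace w}
    (hB : ∀ g h : StateSpace w,
      ∀ᵐ v : Velocity, B g h v = pairCollisionOp qt (fun v v₁ => g v₁ * h v) v)
    (h : StateSpace w) :
    (∫ v, φ v * B g h v) + ∫ v, φ v * B h g v = ∫ v, adjointOp qt g φ v * h v := by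
  have hc := nonneg_of_abs_le_mul_weight hw hφc
  have hkey : ∀ g h : StateSpace w, ∫ v, φ v * B g h v =
      ∫ x : Velocity × Velocity × UnitSphere, kernel qt (x.1 - x.2.1) x.2.2 *
          ((φ (post x.1 x.2.1 x.2.2) - φ x.1) * (g x.2.1 * h x.1)) ∂collisionMeasure := by
    intro g h
    rw [← (integrable_mul_pairCollisionOp hqt hC hw (G := fun v v₁ => g v₁ * h v)
      (integrable_weight_pair hw g h).1 hφ hφc).2.1]
    refine integral_congr_ae ?_
    filter_upwards [hB g h] with v hv
    rw [hv]
  have hint : ∀ g h : StateSpace w, Integrable (fun x : Velocity × Velocity × UnitSphere =>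
      kernel qt (x.1 - x.2.1) x.2.2 *
        ((φ (post x.1 x.2.1 x.2.2) - φ x.1) * (g x.2.1 * h x.1))) collisionMeasure := by
    intro g h
    refine (integrable_kernel_mul_pair hqt hC hw (G := fun v v₁ => g v₁ * h v)
      (integrable_weight_pair hw g h).1 (ψ := fun x => φ (post x.1 x.2.1 x.2.2) - φ x.1)
      ((hφ.comp continuous_post.measurable).sub (hφ.comp measurable_fst)) (c := 2 * c)
      fun x => ?_).1
    have h1 := (hφc _).trans (mul_le_mul_of_nonneg_left (hw.collision_le x.1 x.2.1 x.2.2) hc)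
    have h2 := (hφc _).trans (mul_le_mul_of_nonneg_left (hw.le_mul_left x.1 x.2.1) hc)
    rw [abs_le] at *
    constructor <;> linarith
  have hrel : ∀ x : Velocity × Velocity × UnitSphere,
      (fun x : Velocity × Velocity × UnitSphere => kernel qt (x.1 - x.2.1) x.2.2 *
        ((φ (post x.1 x.2.1 x.2.2) - φ x.1) * (h x.2.1 * g x.1))) (relabel x) =
      kernel qt (x.1 - x.2.1) x.2.2 *
        ((φ (post₁ x.1 x.2.1 x.2.2) - φ x.2.1) * (h x.1 * g x.2.1)) := fun x => by
    simp only [relabel, post_swap_neg]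
    rw [← neg_sub x.1 x.2.1, kernel_neg_neg]
  have h1 := integral_comp_of_measurePreserving measurePreserving_relabel
    (hint h g).aestronglyMeasurable
  have h2 := measurePreserving_relabel.integrable_comp_of_integrable (hint h g)
  simp only [fun x => hrel x] at h1
  replace h2 := h2.congr (ae_of_all _ hrel)
  have hsum := (hint g h).add h2
  rw [hkey g h, hkey h g, ← h1, ← integral_add (hint g h) h2]
  refine (integral_prod _ hsum).trans (integral_congr_ae (ae_of_all _ fun v => ?_))
  simp only [Pi.add_apply]
  rw [adjointOp_eq_integral_prod hqt hC hw g hφ hφc, ← integral_mul_const]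
  exact integral_congr_ae (ae_of_all _ fun y => by ring)

end Adjoint

/-! ### Solvability of the adjoint equation -/

/-- The subspace of measurable functions in the space of bounded functions on velocity space. -/
def boundedMeasurableSubmodule : Submodule ℝ (lp (fun _ : Velocity => ℝ) ∞) where
  carrier := {y | Measurable (y : Velocity → ℝ)}
  add_mem' {y z} (hy : Measurable y) (hz : Measurable z) :=
    show Measurable (⇑(y + z)) by rw [lp.coeFn_add]; exact hy.add hz
  zero_mem' :=
    show Measurable (⇑(0 : lp (fun _ : Velocity => ℝ) ∞)) by
      rw [lp.coeFn_zero]; exact measurable_const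
  smul_mem' a y (hy : Measurable y) :=
    show Measurable (⇑(a • y)) by rw [lp.coeFn_smul]; exact hy.const_smul a

theorem isClosed_boundedMeasurableSubmodule :
    IsClosed (boundedMeasurableSubmodule : Set (lp (fun _ : Velocity => ℝ) ∞)) := by
  refine IsSeqClosed.isClosed fun y z (hy : ∀ n, Measurable (y n)) hz => ?_
  refine measurable_of_tendsto_metrizable hy (tendsto_pi_nhds.2 fun v => ?_)
  exact ((lp.evalCLM ℝ (fun _ : Velocity => ℝ) ∞ v).continuous.tendsto z).comp hz

/-- The Banach space of bounded measurable functions on velocity space with the supremum norm. Its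
elements are functions, not classes of functions modulo null sets. -/
def BoundedMeasurable : Type :=
  boundedMeasurableSubmodule

namespace BoundedMeasurable

noncomputable instance : NormedAddCommGroup BoundedMeasurable :=
  inferInstanceAs (NormedAddCommGroup boundedMeasurableSubmodule)

noncomputable instance : NormedSpace ℝ BoundedMeasurable :=
  inferInstanceAs (NormedSpace ℝ boundedMeasurableSubmodule)

instance : CompleteSpace BoundedMeasurable :=
  have : IsClosed (boundedMeasurableSubmodule : Set (lp (fun _ : Velocity => ℝ) ∞)) :=
    isClosed_boundedMeasurableSubmodule
  this.completeSpace_coe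

/-- The value of a bounded measurable function at `v`. -/
noncomputable def eval (v : Velocity) : BoundedMeasurable →L[ℝ] ℝ :=
  (lp.evalCLM ℝ (fun _ : Velocity => ℝ) ∞ v).comp boundedMeasurableSubmodule.subtypeL

theorem measurable_eval (y : BoundedMeasurable) : Measurable fun v => eval v y :=
  y.2

theorem abs_eval_le (y : BoundedMeasurable) (v : Velocity) : |eval v y| ≤ ‖y‖ :=
  lp.norm_apply_le_norm ENNReal.top_ne_zero y.1 v

theorem exists_eval_eq {z : Velocity → ℝ} (hz : Measurable z) {c : ℝ} (hc : ∀ v, |z v| ≤ c) :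
    ∃ y : BoundedMeasurable, (∀ v, eval v y = z v) ∧ ‖y‖ ≤ c := by
  have hmem : Memℓp z ∞ := memℓp_infty ⟨c, by rintro _ ⟨v, rfl⟩; exact hc v⟩
  exact ⟨⟨⟨z, hmem⟩, hz⟩, fun v => rfl,
    lp.norm_le_of_forall_le ((abs_nonneg _).trans (hc 0)) hc⟩

theorem ext_eval {y z : BoundedMeasurable} (h : ∀ v, eval v y = eval v z) : y = z :=
  Subtype.ext (lp.ext (funext h))

end BoundedMeasurable

open BoltzmannAdjoint.BoundedMeasurable (eval)

variable {qt : ℝ → ℝ → ℝ} {w r : Velocity → ℝ}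

/-- In terms of `y = γ / w`, the adjoint operator is a bounded bilinear map of the state and the
bounded measurable function `y`. -/
theorem exists_clm_adjointOp (hqt : IsCollisionKernel qt) (hw : IsCollisionWeight w) :
    ∃ A : StateSpace w →L[ℝ] BoundedMeasurable →L[ℝ] BoundedMeasurable,
      ∀ (g : StateSpace w) (y : BoundedMeasurable) (v : Velocity),
        w v * eval v (A g y) =
          adjointOp qt g (fun v => w v * eval v y) v := by
  obtain ⟨C, hC⟩ := hqt.bounded
  set γ : BoundedMeasurable → Velocity → ℝ :=
    fun y v => w v * eval v y with hγ
  have hγm : ∀ y, Measurable (γ y) := fun y => hw.measurable.mul y.measurable_eval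
  have hγb : ∀ y v, |γ y v| ≤ ‖y‖ * w v := fun y v => by
    rw [hγ, abs_mul, abs_of_pos (hw.pos v), mul_comm]
    exact mul_le_mul_of_nonneg_right (y.abs_eval_le v) (hw.pos v).le
  have hex : ∀ (g : StateSpace w) (y : BoundedMeasurable), ∃ z : BoundedMeasurable,
      (∀ v, eval v z = adjointOp qt g (γ y) v / w v) ∧
        ‖z‖ ≤ 4 * ‖y‖ * C * ‖g‖ := fun g y =>
    BoundedMeasurable.exists_eval_eq
      ((measurable_adjointOp hqt hC hw g (hγm y) (hγb y)).div hw.measurable)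
      fun v => by
        rw [Pi.div_apply, abs_div, abs_of_pos (hw.pos v), div_le_iff₀ (hw.pos v)]
        exact (integrable_adjointIntegrand hqt hC hw g (hγm y) (hγb y) v).2
  choose A hA hAn using hex
  have hint := fun (g : StateSpace w) (y : BoundedMeasurable) (v : Velocity) =>
    (integrable_adjointIntegrand hqt hC hw g (hγm y) (hγb y) v).1
  have hA' : ∀ g y v, eval v (A g y) =
      (∫ x : Velocity × UnitSphere, g x.1 * (γ y (post v x.1 x.2) + γ y (post₁ v x.1 x.2) - γ y v -
        γ y x.1) * kernel qt (v - x.1) x.2 ∂((volume : Measure Velocity).prod sphereMeasure)) /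
          w v := fun g y v => by
    rw [hA, adjointOp_eq_integral_prod hqt hC hw g (hγm y) (hγb y)]
  have hfst : ∀ {p : Velocity → Prop}, (∀ᵐ v : Velocity, p v) →
      ∀ᵐ x : Velocity × UnitSphere ∂((volume : Measure Velocity).prod sphereMeasure), p x.1 :=
    fun h => Measure.quasiMeasurePreserving_fst.ae h
  let Al : StateSpace w →ₗ[ℝ] BoundedMeasurable →ₗ[ℝ] BoundedMeasurable := LinearMap.mk₂ ℝ A
    (fun g g' y => by
      refine BoundedMeasurable.ext_eval fun v => ?_
      rw [map_add, hA', hA', hA', ← add_div,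
        ← integral_add (hint g y v) (hint g' y v)]
      congr 1
      refine integral_congr_ae ?_
      filter_upwards [hfst (coeFn_add_ae hw g g')] with x hx
      rw [hx]; ring)
    (fun a g y => by
      refine BoundedMeasurable.ext_eval fun v => ?_
      rw [map_smul, smul_eq_mul, hA', hA', ← mul_div_assoc,
        ← integral_const_mul]
      congr 1
      refine integral_congr_ae ?_
      filter_upwards [hfst (coeFn_smul_ae hw a g)] with x hx
      rw [hx]; ring)
    (fun g y y' => by
      refine BoundedMeasurable.ext_eval fun v => ?_
      rw [map_add, hA', hA', hA', ← add_div,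
        ← integral_add (hint g y v) (hint g y' v)]
      congr 1
      refine integral_congr_ae (ae_of_all _ fun x => ?_)
      simp only [hγ, map_add]
      ring)
    (fun a g y => by
      refine BoundedMeasurable.ext_eval fun v => ?_
      rw [map_smul, smul_eq_mul, hA', hA', ← mul_div_assoc,
        ← integral_const_mul]
      congr 1
      refine integral_congr_ae (ae_of_all _ fun x => ?_)
      simp only [hγ, map_smul, smul_eq_mul]
      ring)
  -- the factor `4` counts the four values of `γ` in the integrand
  refine ⟨Al.mkContinuous₂ (4 * C) fun g y => (hAn g y).trans_eq (by ring), fun g y v => ?_⟩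
  change w v * eval v (A g y) = adjointOp qt g (γ y) v
  rw [hA, mul_div_cancel₀ _ (hw.pos v).ne']

theorem continuousOn_of_isBoltzmannSolution {a b : ℝ} {F : ℝ → StateSpace w}
    (hF : IsBoltzmannSolution qt w a b F) : ContinuousOn F (Icc a b) := fun s hs =>
  (hF s hs).choose_spec.2.continuousWithinAt

theorem exists_isAdjointSolution (hqt : IsCollisionKernel qt) (hw : IsCollisionWeight w)
    (hr : Measurable r) (hrw : ∃ C : ℝ, ∀ v, |r v| ≤ C * w v) {T : ℝ} (hT : 0 ≤ T)
    {f : ℝ → StateSpace w} (hf : ContinuousOn f (Icc 0 T)) :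
    ∃ γ : ℝ → Velocity → ℝ, IsAdjointSolution qt w r T f γ := by
  obtain ⟨c, hc⟩ := hrw
  obtain ⟨A, hA⟩ := exists_clm_adjointOp hqt hw
  obtain ⟨M, hM⟩ := exists_norm_le_of_continuousOn hf
  obtain ⟨y₀, hy₀, -⟩ := BoundedMeasurable.exists_eval_eq (hr.neg.div hw.measurable) (c := c)
    fun v => by
      simp only [Pi.neg_apply, Pi.div_apply]
      rw [abs_div, abs_neg, abs_of_pos (hw.pos v), div_le_iff₀ (hw.pos v)]
      exact hc v
  have hrev : MapsTo (fun s => T - s) (Icc 0 T) (Icc 0 T) := fun s hs =>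
    ⟨by linarith [hs.2], by linarith [hs.1]⟩
  -- in the reversed time `T - s` the adjoint equation is a forward linear equation for `γ / w`
  obtain ⟨y, hy0, hy⟩ := exists_solution_of_lipschitzOnWith_closedBall hT
    (V := fun s z => A (f (T - s)) z) (K := ‖A‖₊ * M)
    (R := ‖y₀‖ * Real.exp ((‖A‖₊ * M : ℝ≥0) * (T - 0)) + 1) (by positivity)
    (fun z => ((ContinuousLinearMap.apply ℝ _ z).continuous.comp A.continuous).comp_continuousOn
      (hf.comp (by fun_prop) hrev))
    (fun s _ => map_zero _)
    (fun s hs => (LipschitzWith.of_dist_le_mul fun z z' => by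
      rw [dist_eq_norm, dist_eq_norm, ← map_sub]
      refine (A.le_opNorm₂ _ _).trans ?_
      rw [NNReal.coe_mul, coe_nnnorm]
      gcongr
      exact hM _ (hrev hs)).lipschitzOnWith)
    y₀ (by linarith)
  refine ⟨fun s v => w v * eval v (y (T - s)), ?_, ?_, ?_, ?_⟩
  · exact fun t ht => hw.measurable.mul (y (T - t)).measurable_eval
  · refine ⟨‖y₀‖ * Real.exp ((‖A‖₊ * M : ℝ≥0) * (T - 0)), fun t ht v => ?_⟩
    rw [abs_mul, abs_of_pos (hw.pos v), mul_comm]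
    refine mul_le_mul_of_nonneg_right (((y (T - t)).abs_eval_le v).trans
      ((hy _ (hrev ht)).2.trans ?_)) (hw.pos v).le
    gcongr
    exact (hrev ht).2
  · intro t ht v
    have h1 := (hy _ (hrev ht)).1.scomp t
      ((hasDerivAt_id t).const_sub T).hasDerivWithinAt hrev
    have h2 := ((eval v).hasFDerivAt.comp_hasDerivWithinAt t h1).const_mul (w v)
    convert! h2 using 1
    rw [← hA]
    simp
  · intro v
    have : y (T - T) = y₀ := by rw [sub_self, hy0]
    simp only [this, hy₀, Pi.div_apply, Pi.neg_apply]
    rw [mul_div_cancel₀ _ (hw.pos v).ne']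

/-! ### Solutions of the Boltzmann equation near a given one -/

section Boltzmann

variable {qt : ℝ → ℝ → ℝ} {w r : Velocity → ℝ} (hw : IsCollisionWeight w)
  {B : StateSpace w →L[ℝ] StateSpace w →L[ℝ] StateSpace w}
  (hB : ∀ g h : StateSpace w,
    ∀ᵐ v : Velocity, B g h v = pairCollisionOp qt (fun v v₁ => g v₁ * h v) v)

include hw hB in
theorem isBoltzmannSolution_iff {a b : ℝ} {F : ℝ → StateSpace w} :
    IsBoltzmannSolution qt w a b F ↔
      ∀ s ∈ Icc a b, HasDerivWithinAt F (B (F s) (F s)) (Icc a b) s := by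
  refine ⟨fun h s hs => ?_, fun h s hs => ⟨_, hB (F s) (F s), h s hs⟩⟩
  obtain ⟨g, hg, hg'⟩ := h s hs
  have : g = B (F s) (F s) := stateSpace_ext hw (by
    filter_upwards [hg, hB (F s) (F s)] with v h1 h2
    rw [h1, h2, collisionOp_eq_pairCollisionOp])
  rwa [this] at hg'

include hw hB in
theorem eqOn_of_isBoltzmannSolution {a b : ℝ} {F F' : ℝ → StateSpace w}
    (hF : IsBoltzmannSolution qt w a b F) (hF' : IsBoltzmannSolution qt w a b F')
    (h : F a = F' a) : EqOn F F' (Icc a b) :=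
  eqOn_of_hasDerivWithinAt_quadratic B ((isBoltzmannSolution_iff hw hB).1 hF)
    ((isBoltzmannSolution_iff hw hB).1 hF') h

include hw hB in
theorem exists_isBoltzmannSolution_near {a b : ℝ} (hab : a ≤ b) {f : ℝ → StateSpace w}
    (hf : IsBoltzmannSolution qt w a b f) :
    ∃ δ > 0, ∃ L : ℝ, ∀ g : StateSpace w, ‖g - f a‖ ≤ δ → ∃ F : ℝ → StateSpace w,
      IsBoltzmannSolution qt w a b F ∧ F a = g ∧
        ∀ s ∈ Icc a b, ‖F s - f s‖ ≤ L * ‖g - f a‖ := by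
  simp only [isBoltzmannSolution_iff hw hB] at hf ⊢
  exact exists_hasDerivWithinAt_quadratic_near B hab hf

include hw hB in
theorem isUniquelySolvable_of_isBoltzmannSolution {a b : ℝ} {F : ℝ → StateSpace w}
    (hF : IsBoltzmannSolution qt w a b F) : IsUniquelySolvable qt w a b (F a) :=
  ⟨F, ⟨hF, rfl⟩, fun _ hF' h => eqOn_of_isBoltzmannSolution hw hB hF' hF h⟩

include hw hB in
theorem finalState_eq {a b : ℝ} (hab : a ≤ b) {F : ℝ → StateSpace w}
    (hF : IsBoltzmannSolution qt w a b F) : finalState qt w a b (F a) = F b := by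
  have h : ∃ F' : ℝ → StateSpace w, IsBoltzmannSolution qt w a b F' ∧ F' a = F a := ⟨F, hF, rfl⟩
  rw [finalState, dif_pos h]
  exact eqOn_of_isBoltzmannSolution hw hB h.choose_spec.1 hF h.choose_spec.2 (right_mem_Icc.2 hab)

theorem IsBoltzmannSolution.mono {a b a' : ℝ} (ha : a ≤ a') {F : ℝ → StateSpace w}
    (hF : IsBoltzmannSolution qt w a b F) : IsBoltzmannSolution qt w a' b F := fun s hs =>
  let ⟨g, hg, hd⟩ := hF s (Icc_subset_Icc_left ha hs)
  ⟨g, hg, hd.mono (Icc_subset_Icc_left ha)⟩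

end Boltzmann

/-! ### Differentiation of the duality pairing -/

section Pairing

variable {w : Velocity → ℝ} (hw : IsCollisionWeight w)

include hw in
/-- Product rule for `∫ γ(v, s) h(v, s) dv`, where `h` is differentiable in the norm of the state
space but `γ` only at each velocity separately, with a derivative bounded by the weight. -/
theorem hasDerivWithinAt_integral_mul {a b : ℝ} {γ γ' : ℝ → Velocity → ℝ} {c c' : ℝ}
    (hγ : ∀ s ∈ Icc a b, Measurable (γ s)) (hγc : ∀ s ∈ Icc a b, ∀ v, |γ s v| ≤ c * w v)
    (hγ' : ∀ s ∈ Icc a b, ∀ v, |γ' s v| ≤ c' * w v)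
    (hd : ∀ s ∈ Icc a b, ∀ v, HasDerivWithinAt (fun s => γ s v) (γ' s v) (Icc a b) s)
    {h : ℝ → StateSpace w} {h' : StateSpace w} {s₀ : ℝ} (hs₀ : s₀ ∈ Icc a b)
    (hh : HasDerivWithinAt h h' (Icc a b) s₀) :
    HasDerivWithinAt (fun s => ∫ v, γ s v * h s v)
      ((∫ v, γ' s₀ v * h s₀ v) + ∫ v, γ s₀ v * h' v) (Icc a b) s₀ := by
  have hlip : ∀ s ∈ Icc a b, ∀ v, |γ s v - γ s₀ v| ≤ c' * |s - s₀| * w v := fun s hs v => by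
    have := (convex_Icc a b).norm_image_sub_le_of_norm_hasDerivWithin_le
      (fun x hx => hd x hx v) (fun x hx => hγ' x hx v) hs₀ hs
    rw [Real.norm_eq_abs, Real.norm_eq_abs] at this
    linarith
  have hdm : ∀ s ∈ Icc a b, Measurable fun v => γ s v - γ s₀ v := fun s hs =>
    (hγ s hs).sub (hγ s₀ hs₀)
  obtain ⟨D, hD⟩ := exists_clm_integral_mul hw (hγ s₀ hs₀) (hγc s₀ hs₀)
  -- the derivative falls on `h`
  have h1 : HasDerivWithinAt (fun s => ∫ v, γ s₀ v * h s v) (∫ v, γ s₀ v * h' v) (Icc a b) s₀ := by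
    simpa only [Function.comp_def, hD] using D.hasFDerivAt.comp_hasDerivWithinAt s₀ hh
  -- the derivative falls on `γ`: dominated convergence of the difference quotients
  have h2 : HasDerivWithinAt (fun s => ∫ v, (γ s v - γ s₀ v) * h s₀ v) (∫ v, γ' s₀ v * h s₀ v)
      (Icc a b) s₀ := by
    rw [hasDerivWithinAt_iff_tendsto_slope]
    have hmem : ∀ᶠ s in 𝓝[Icc a b \ {s₀}] s₀, s ∈ Icc a b \ {s₀} := self_mem_nhdsWithin
    have hslope : slope (fun s => ∫ v, (γ s v - γ s₀ v) * h s₀ v) s₀ =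
        fun s => ∫ v, slope (fun s => γ s v) s₀ s * h s₀ v := by
      funext s
      simp only [slope, vsub_eq_sub, smul_eq_mul, sub_self, zero_mul, integral_zero, sub_zero]
      rw [← integral_const_mul]
      exact integral_congr_ae (ae_of_all _ fun v => by ring)
    rw [hslope]
    refine tendsto_integral_filter_of_dominated_convergence
      (fun v => c' * ‖w v * h s₀ v‖) ?_ ?_ ((integrable_weight_mul hw _).norm.const_mul c') ?_
    · filter_upwards [hmem] with s hs
      simp only [slope, vsub_eq_sub, smul_eq_mul]
      have := (integrable_mul_stateSpace hw (hdm s hs.1) (hlip s hs.1) (h s₀)).1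
      refine (this.const_mul (s - s₀)⁻¹).aestronglyMeasurable.congr (ae_of_all _ fun v => ?_)
      ring
    · filter_upwards [hmem] with s hs
      refine ae_of_all _ fun v => ?_
      have hne : 0 < |s - s₀| := abs_pos.2 (sub_ne_zero.2 hs.2)
      have := hlip s hs.1 v
      rw [norm_mul, norm_mul, Real.norm_of_nonneg (hw.pos v).le, ← mul_assoc]
      refine mul_le_mul_of_nonneg_right ?_ (norm_nonneg _)
      simp only [slope, vsub_eq_sub, smul_eq_mul, norm_mul, norm_inv, Real.norm_eq_abs]
      rw [inv_mul_le_iff₀ hne]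
      linarith
    · refine ae_of_all _ fun v => ?_
      exact ((hasDerivWithinAt_iff_tendsto_slope.1 (hd s₀ hs₀ v)).mul_const _)
  -- the product of the two increments is of second order
  have h3 : HasDerivWithinAt (fun s => ∫ v, (γ s v - γ s₀ v) * (h s - h s₀) v) 0
      (Icc a b) s₀ := by
    rw [hasDerivWithinAt_iff_isLittleO]
    have hlim : Tendsto (fun s => h s - h s₀) (𝓝[Icc a b] s₀) (𝓝 0) := by
      have := hh.continuousWithinAt.tendsto.sub_const (h s₀)
      rwa [sub_self] at this
    have ho := (Asymptotics.isBigO_refl (fun s => s - s₀) (𝓝[Icc a b] s₀)).mul_isLittleO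
      ((Asymptotics.isLittleO_one_iff ℝ).2 (tendsto_zero_iff_norm_tendsto_zero.1 hlim))
    simp only [mul_one] at ho
    refine Asymptotics.IsBigO.trans_isLittleO ?_ ho
    refine Asymptotics.IsBigO.of_bound c' ?_
    filter_upwards [self_mem_nhdsWithin] with s hs
    simp only [sub_self, zero_mul, integral_zero, smul_zero, sub_zero]
    rw [norm_mul, norm_norm, ← mul_assoc]
    exact (integrable_mul_stateSpace hw (hdm s hs) (hlip s hs) (h s - h s₀)).2
  have hsum := (h2.add h1).add h3
  rw [add_zero] at hsum
  refine hsum.congr (fun s hs => ?_) ?_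
  · simp only [Pi.add_apply]
    have i1 := (integrable_mul_stateSpace hw (hγ s₀ hs₀) (hγc s₀ hs₀) (h s)).1
    have i2 := (integrable_mul_stateSpace hw (hdm s hs) (hlip s hs) (h s₀)).1
    have i3 := (integrable_mul_stateSpace hw (hdm s hs) (hlip s hs) (h s - h s₀)).1
    have i12 : Integrable fun v => (γ s v - γ s₀ v) * h s₀ v + γ s₀ v * h s v := i2.add i1
    rw [← integral_add i2 i1, ← integral_add i12 i3]
    refine integral_congr_ae ?_
    filter_upwards [coeFn_sub_ae hw (h s) (h s₀)] with v hv
    rw [hv]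
    ring
  · simp

include hw in
/-- Functions are determined by their integrals against the state space: it contains a strictly
positive function, and with it the restrictions of that function to all measurable sets. -/
theorem ae_eq_of_forall_integral_mul_eq {φ ψ : Velocity → ℝ}
    (hφ : ∀ h : StateSpace w, Integrable fun v => φ v * h v)
    (hψ : ∀ h : StateSpace w, Integrable fun v => ψ v * h v)
    (heq : ∀ h : StateSpace w, ∫ v, φ v * h v = ∫ v, ψ v * h v) : ∀ᵐ v : Velocity, φ v = ψ v := by
  obtain ⟨k, hk0, hkm, hk⟩ := exists_pos_lintegral_lt_of_sigmaFinite
    ((volume : Measure Velocity).withDensity fun v => ENNReal.ofReal (w v)) one_ne_zero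
  have hki : Integrable (fun v => (k v : ℝ))
      ((volume : Measure Velocity).withDensity fun v => ENNReal.ofReal (w v)) := by
    refine ⟨hkm.coe_nnreal_real.aestronglyMeasurable, ?_⟩
    refine lt_of_le_of_lt (lintegral_mono fun v => ?_) (hk.trans ENNReal.one_lt_top)
    simp
  have hex : ∀ s : Set Velocity, MeasurableSet s → ∃ h : StateSpace w,
      ∀ᵐ v : Velocity, h v = s.indicator (fun v => (k v : ℝ)) v := fun s hs =>
    exists_stateSpace_ae_eq hw ((integrable_withDensity_weight_iff hw).1 (hki.indicator hs))
  have hmul : ∀ (χ : Velocity → ℝ) (s : Set Velocity) (h : StateSpace w),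
      (∀ᵐ v : Velocity, h v = s.indicator (fun v => (k v : ℝ)) v) →
      (fun v => χ v * h v) =ᵐ[volume] s.indicator fun v => χ v * k v := by
    intro χ s h hh
    filter_upwards [hh] with v hv
    rw [hv]
    by_cases hvs : v ∈ s <;> simp [hvs]
  have hint : ∀ χ : Velocity → ℝ, (∀ h : StateSpace w, Integrable fun v => χ v * h v) →
      Integrable fun v => χ v * k v := fun χ hχ => by
    obtain ⟨h, hh⟩ := hex univ MeasurableSet.univ
    simpa using (hχ h).congr (hmul χ univ h hh)
  have hae := Integrable.ae_eq_of_forall_setIntegral_eq _ _ (hint φ hφ) (hint ψ hψ)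
    fun s hs _ => by
      obtain ⟨h, hh⟩ := hex s hs
      rw [← integral_indicator hs, ← integral_indicator hs, ← integral_congr_ae (hmul φ s h hh),
        ← integral_congr_ae (hmul ψ s h hh), heq h]
  filter_upwards [hae] with v hv
  exact mul_right_cancel₀ (NNReal.coe_pos.2 (hk0 v)).ne' hv

end Pairing

/-! ### The derivative of the objective -/

section Objective

variable {qt : ℝ → ℝ → ℝ} (hqt : IsCollisionKernel qt) {w r : Velocity → ℝ}
  (hw : IsCollisionWeight w)
  {B : StateSpace w →L[ℝ] StateSpace w →L[ℝ] StateSpace w}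
  (hB : ∀ g h : StateSpace w,
    ∀ᵐ v : Velocity, B g h v = pairCollisionOp qt (fun v v₁ => g v₁ * h v) v)
  {T : ℝ} {f : ℝ → StateSpace w} (hf : IsBoltzmannSolution qt w 0 T f)
  {γ : ℝ → Velocity → ℝ} (hγ : IsAdjointSolution qt w r T f γ)

include hqt hw hB in
theorem integral_mul_quadratic_sub {C : ℝ≥0}
    (hC : ∀ u, ∫⁻ σ, ENNReal.ofReal (kernel qt u σ) ∂sphereMeasure ≤ C) {φ : Velocity → ℝ}
    (hφ : Measurable φ) {c : ℝ} (hφc : ∀ v, |φ v| ≤ c * w v) (x y : StateSpace w) :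
    (∫ v, -adjointOp qt y φ v * (x - y) v) + ∫ v, φ v * (B x x - B y y) v =
      ∫ v, φ v * (B (x - y) (x - y)) v := by
  obtain ⟨D, hD⟩ := exists_clm_integral_mul hw hφ hφc
  have hdual := integral_mul_linearised_eq hqt hC hw y hφ hφc hB (x - y)
  have hsplit := (hD _).symm.trans ((apply_quadratic_sub_quadratic B D x y).trans
    (congrArg₂ (· + ·) (congrArg₂ (· + ·) (hD _) (hD _)) (hD _)))
  have hneg : ∫ v, -adjointOp qt y φ v * (x - y) v = -∫ v, adjointOp qt y φ v * (x - y) v := by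
    simp only [neg_mul, integral_neg]
  have key : ∀ {N I I₁ I₂ I₃ S : ℝ}, N = -I → I₁ + I₂ = I → S = I₁ + I₂ + I₃ → N + S = I₃ := by
    intros; linarith
  exact key hneg hdual hsplit

include hqt hw hB hf hγ in
/-- Along the difference `h` of two solutions the pairing `∫ γ h` has derivative `∫ γ B(h, h)`: the
terms linear in `h` cancel by duality. The pairing is therefore constant up to second order. -/
theorem exists_abs_pairing_sub_le {t : ℝ} (ht : t ∈ Icc 0 T) (L : ℝ) :
    ∃ A : ℝ, ∀ F : ℝ → StateSpace w, IsBoltzmannSolution qt w t T F →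
      (∀ s ∈ Icc t T, ‖F s - f s‖ ≤ L * ‖F t - f t‖) →
      |(∫ v, γ T v * (F T - f T) v) - ∫ v, γ t v * (F t - f t) v| ≤ A * ‖F t - f t‖ ^ 2 := by
  obtain ⟨C, hC⟩ := hqt.bounded
  obtain ⟨c, hc⟩ := hγ.bounded
  have hsub : Icc t T ⊆ Icc 0 T := Icc_subset_Icc_left ht.1
  have hc0 : 0 ≤ c := nonneg_of_abs_le_mul_weight hw (hc t ht)
  have hft := IsBoltzmannSolution.mono ht.1 hf
  obtain ⟨M, hM⟩ := exists_norm_le_of_continuousOn (continuousOn_of_isBoltzmannSolution hft)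
  rw [isBoltzmannSolution_iff hw hB] at hft
  refine ⟨c * (‖B‖ * L ^ 2) * (T - t), fun F hF hL => ?_⟩
  rw [isBoltzmannSolution_iff hw hB] at hF
  have hder : ∀ s ∈ Icc t T, HasDerivWithinAt (fun s => ∫ v, γ s v * (F s - f s) v)
      (∫ v, γ s v * (B (F s - f s) (F s - f s)) v) (Icc t T) s := by
    intro s hs
    have h := hasDerivWithinAt_integral_mul hw (γ := γ)
      (γ' := fun s v => -adjointOp qt (f s) (γ s) v) (c := c) (c' := 4 * c * C * M)
      (fun s hs => hγ.measurable s (hsub hs)) (fun s hs => hc s (hsub hs))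
      (fun s hs v => by
        have hwv := (hw.pos v).le
        rw [abs_neg]
        refine (integrable_adjointIntegrand hqt hC hw (f s) (hγ.measurable s (hsub hs))
          (hc s (hsub hs)) v).2.trans ?_
        gcongr
        exact hM s hs)
      (fun s hs v => (hγ.backward s (hsub hs) v).mono hsub) hs ((hF s hs).sub (hft s hs))
    convert! h using 1
    exact (integral_mul_quadratic_sub hqt hw hB hC (hγ.measurable s (hsub hs))
      (hc s (hsub hs)) (F s) (f s)).symm
  have hbd : ∀ s ∈ Icc t T, ‖∫ v, γ s v * (B (F s - f s) (F s - f s)) v‖ ≤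
      c * (‖B‖ * L ^ 2) * ‖F t - f t‖ ^ 2 := by
    intro s hs
    have h1 := (integrable_mul_stateSpace hw (hγ.measurable s (hsub hs)) (hc s (hsub hs))
      (B (F s - f s) (F s - f s))).2
    calc _ ≤ c * (‖B‖ * ‖F s - f s‖ * ‖F s - f s‖) :=
          h1.trans (mul_le_mul_of_nonneg_left (B.le_opNorm₂ _ _) hc0)
      _ = c * ‖B‖ * ‖F s - f s‖ ^ 2 := by ring
      _ ≤ c * ‖B‖ * (L * ‖F t - f t‖) ^ 2 := by
          have := hL s hs
          gcongr
      _ = _ := by ring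
  have := (convex_Icc t T).norm_image_sub_le_of_norm_hasDerivWithin_le hder hbd
    (left_mem_Icc.2 ht.2) (right_mem_Icc.2 ht.2)
  refine this.trans_eq ?_
  rw [Real.norm_of_nonneg (sub_nonneg.2 ht.2)]
  ring

include hqt hw hB hf hγ in
theorem isFunctionalDerivative_objective (hr : Measurable r)
    (hrw : ∃ C : ℝ, ∀ v, |r v| ≤ C * w v) {t : ℝ} (ht : t ∈ Icc 0 T) :
    IsFunctionalDerivative (objective qt w r t T) (f t) fun v => -γ t v := by
  obtain ⟨c, hc⟩ := hγ.bounded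
  obtain ⟨cr, hcr⟩ := hrw
  have hm : Measurable fun v => -γ t v := (hγ.measurable t ht).neg
  have hmc : ∀ v, |-γ t v| ≤ c * w v := fun v => by rw [abs_neg]; exact hc t ht v
  have hft := IsBoltzmannSolution.mono ht.1 hf
  obtain ⟨D, hD⟩ := exists_clm_integral_mul hw hm hmc
  obtain ⟨R, hR⟩ := exists_clm_integral_mul hw hr hcr
  obtain ⟨δ, hδ, L, hnear⟩ := exists_isBoltzmannSolution_near hw hB ht.2 hft
  obtain ⟨A, hA⟩ := exists_abs_pairing_sub_le hqt hw hB hf hγ ht L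
  refine ⟨D, ?_, fun h => ⟨(integrable_mul_stateSpace hw hm hmc h).1, hD h⟩⟩
  have hO : (fun g => objective qt w r t T g - objective qt w r t T (f t) - D (g - f t))
      =O[𝓝 (f t)] fun g => ‖g - f t‖ ^ 2 := by
    refine Asymptotics.IsBigO.of_bound A ?_
    filter_upwards [Metric.closedBall_mem_nhds (f t) hδ] with g hg
    rw [Metric.mem_closedBall, dist_eq_norm] at hg
    obtain ⟨F, hF, rfl, hFL⟩ := hnear g hg
    have h1 := hA F hF hFL
    simp only [hγ.final, neg_mul, integral_neg] at h1
    have h2 : ∀ G : StateSpace w, ∫ v, γ t v * G v = -D G := fun G => by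
      rw [hD]; simp only [neg_mul, integral_neg, neg_neg]
    rw [h2, ← hR, map_sub] at h1
    rw [objective, objective, finalState_eq hw hB ht.2 hF, finalState_eq hw hB ht.2 hft, ← hR, ← hR,
      norm_pow, norm_norm, Real.norm_eq_abs, ← abs_neg]
    refine le_trans (le_of_eq ?_) h1
    congr 1
    ring
  have h0 := hO.hasFDerivAt (𝕜 := ℝ) one_lt_two
  have h1 : HasFDerivAt (fun g => D (g - f t)) D (f t) := by
    simpa only [map_sub] using D.hasFDerivAt.sub_const (D (f t))
  have h2 := (h0.add h1).add_const (objective qt w r t T (f t))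
  rw [zero_add] at h2
  refine h2.congr_of_eventuallyEq (Eventually.of_forall fun g => ?_)
  simp

include hqt hw hB hf hγ in
theorem ae_eq_neg_of_isFunctionalDerivative (hr : Measurable r)
    (hrw : ∃ C : ℝ, ∀ v, |r v| ≤ C * w v) {t : ℝ} (ht : t ∈ Icc 0 T) {φ : Velocity → ℝ}
    (hφ : IsFunctionalDerivative (objective qt w r t T) (f t) φ) :
    ∀ᵐ v : Velocity, γ t v = -φ v := by
  obtain ⟨D, hD, hDφ⟩ := hφ
  obtain ⟨D', hD', hDγ⟩ := isFunctionalDerivative_objective hqt hw hB hf hγ hr hrw ht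
  obtain rfl := hD.unique hD'
  filter_upwards [ae_eq_of_forall_integral_mul_eq hw (fun h => (hDφ h).1) (fun h => (hDγ h).1)
    fun h => (hDφ h).2.symm.trans (hDγ h).2] with v hv
  rw [hv, neg_neg]

end Objective

end BoltzmannAdjoint

theorem mainTheorem4
    (qt : ℝ → ℝ → ℝ) (hqt : IsCollisionKernel qt)
    (w : Velocity → ℝ) (hw : IsCollisionWeight w)
    (r : Velocity → ℝ) (hr : Measurable r) (hrw : ∃ C : ℝ, ∀ v, |r v| ≤ C * w v)
    (T : ℝ) (hT : 0 ≤ T)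
    (f : ℝ → StateSpace w) (hf : IsBoltzmannSolution qt w 0 T f) :
    (∀ t ∈ Icc 0 T, ∀ᶠ g in 𝓝 (f t), IsUniquelySolvable qt w t T g) ∧
    (∃ γ : ℝ → Velocity → ℝ, IsAdjointSolution qt w r T f γ) ∧
    (∀ γ : ℝ → Velocity → ℝ, IsAdjointSolution qt w r T f γ →
      ∀ t ∈ Icc 0 T,
        IsFunctionalDerivative (objective qt w r t T) (f t) (fun v => -γ t v) ∧
        ∀ φ : Velocity → ℝ, IsFunctionalDerivative (objective qt w r t T) (f t) φ →
          ∀ᵐ v : Velocity, γ t v = -φ v) := by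
  obtain ⟨B, hB⟩ := exists_clm_collisionOp hqt hw
  refine ⟨fun t ht => ?_, exists_isAdjointSolution hqt hw hr hrw hT
    (continuousOn_of_isBoltzmannSolution hf), fun γ hγ t ht =>
      ⟨isFunctionalDerivative_objective hqt hw hB hf hγ hr hrw ht, fun φ hφ =>
        ae_eq_neg_of_isFunctionalDerivative hqt hw hB hf hγ hr hrw ht hφ⟩⟩
  obtain ⟨δ, hδ, L, hnear⟩ := exists_isBoltzmannSolution_near hw hB ht.2
    (IsBoltzmannSolution.mono ht.1 hf)
  filter_upwards [Metric.closedBall_mem_nhds (f t) hδ] with g hg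
  rw [Metric.mem_closedBall, dist_eq_norm] at hg
  obtain ⟨F, hF, rfl, -⟩ := hnear g hg
  exact isUniquelySolvable_of_isBoltzmannSolution hw hB hF
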